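/- Fix $Q>1$, $A\ge 1$ and $K\ge 1$. There is a constant $C\ge 1$, depending only on $Q,A,K$, such that the following holds. Let $(X,d,\mu)$ be a non-empty compact metric space with a Borel measure $\mu$ that is $Q$-Ahlfors regular with constant $A$: $A^{-1}R^Q\le \mu(B(x,R))\le A R^Q$ for every closed ball with $0<R\le \operatorname{diam} X$. Let $(\mathcal S_n)$ be a sequence of $K$-quasi-packings of $X$ whose mesh $\sup_{s\in\mathcal S_n}\operatorname{diam}s$ tends to $0$. Here a $K$-quasi-packing is a locally finite cover $\mathcal S$ of $X$ for which there are, for each $s\in\mathcal S$, a point $x_s\in s$ and a radius $r_s>0$ with $B(x_s,r_s)\subset s\subset B(x_s,Kr_s)$, such that for each $s$ the ball $B(x_s,r_s)$ meets $B(x_{s'},r_{s'})$ for at most $K$ pieces $s'\neq s$. For a family $\Gamma$ of curves (continuous maps $[0,1]\to X$), the analytic modulus is $$\operatorname{mod}_Q\Gamma=\inf_\rho\int_X\rho^Q\,d\mu,$$ over Borel functions $\rho:X\to[0,\infty]$ with $\int_\gamma\rho\,ds\ge1$ for every rectifiable $\gamma\in\Gamma$. The combinatorial modulus with respect to $\mathcal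 S$ is $$\operatorname{mod}_Q(\Gamma,\mathcal S)=\inf_\rho\frac{\sum_{s\in\mathcal S}\rho(s)^Q}{\left(\inf_{\gamma\in\Gamma}\sum_{s\in\mathcal S,\ s\cap\gamma\ne\emptyset}\rho(s)\right)^Q},$$ over weights $\rho:\mathcal S\to[0,\infty)$ with $0<\sum_s\rho(s)^Q<\infty$. The quotient is $+\infty$ if the infimum in the denominator is $0$, and $0$ if $\Gamma=\emptyset$. Let $\Gamma$ be either * $\Gamma_L$, the family of all curves of diameter at least $L$, for some $L>0$; or * $\Gamma(E,F)$, the family of all curves $\gamma$ with $\gamma(0)\in E$ and $\gamma(1)\in F$, where $E,F\subset X$ are disjoint continua (compact connected sets with more than one point). If $\operatorname{mod}_Q\Gamma>0$, then for all $n$ large enough (depending on $\Gamma$) $$\frac1C\operatorname{mod}_Q\Gamma\le\operatorname{mod}_Q(\Gamma,\mathcal S_n)\le C\operatorname{mod}_Q\Gamma .$$ If $\operatorname{mod}_Q\Gamma=0$, then $\lim_{n\to\infty}\operatorname{mod}_Q(\Gamma,\mathcal S_n)=0$. -/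

import Mathlib

open MeasureTheory Filter Topology Set
open scoped ENNReal NNReal

noncomputable section

namespace CombMod

/-! ### Analytic modulus of curve families -/

section Analytic

variable {X : Type*} [MetricSpace X]

/-- A curve in `X` is a continuous map `[0,1] → X`. -/
abbrev Curve (X : Type*) [MetricSpace X] : Type _ := C(unitInterval, X)

/-- The length of a curve, the supremum of `∑ d(γ(t_j), γ(t_{j+1}))` over subdivisions. -/
def curveLength (γ : Curve X) : ℝ≥0∞ := eVariationOn (γ : unitInterval → X) univ

/-- A curve is rectifiable if its length is finite. -/
def Rectifiable (γ : Curve X) : Prop := curveLength γ ≠ ∞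

/-- The arc-length parametrization `γ_s : [0, ℓ(γ)] → X` of a rectifiable curve. -/
def arcLengthParam (γ : Curve X) : ℝ → X :=
  naturalParameterization (γ : unitInterval → X) univ 0

/-- The line integral `∫_γ ρ ds = ∫_0^{ℓ(γ)} ρ(γ_s(t)) dt`, meaningful for rectifiable `γ`. -/
def lineIntegral (ρ : X → ℝ≥0∞) (γ : Curve X) : ℝ≥0∞ :=
  ∫⁻ t in Icc (0 : ℝ) (curveLength γ).toReal, ρ (arcLengthParam γ t)

/-- A Borel function `ρ : X → [0,∞]` is admissible for `Γ` if `∫_γ ρ ds ≥ 1` for every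
rectifiable `γ ∈ Γ`. -/
def Admissible [MeasurableSpace X] (Γ : Set (Curve X)) (ρ : X → ℝ≥0∞) : Prop :=
  Measurable ρ ∧ ∀ γ ∈ Γ, Rectifiable γ → 1 ≤ lineIntegral ρ γ

/-- The analytic `Q`-modulus of a family of curves. -/
def modulus [MeasurableSpace X] (μ : Measure X) (Q : ℝ) (Γ : Set (Curve X)) : ℝ≥0∞ :=
  ⨅ (ρ : X → ℝ≥0∞) (_ : Admissible Γ ρ), ∫⁻ x, ρ x ^ Q ∂μ

/-- `Γ_L`: the curves of diameter at least `L`. -/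
def curvesOfDiam (X : Type*) [MetricSpace X] (L : ℝ) : Set (Curve X) :=
  {γ | L ≤ Metric.diam (range γ)}

/-- `Γ(E,F)`: the curves joining `E` to `F`. -/
def curvesJoining (E F : Set X) : Set (Curve X) :=
  {γ | γ 0 ∈ E ∧ γ 1 ∈ F}

/-- A continuum: a compact connected set which is not reduced to a point. -/
structure IsContinuum (E : Set X) : Prop where
  isCompact : IsCompact E
  isConnected : IsConnected E
  nontrivial : E.Nontrivial

/-- A condenser: a pair of disjoint continua. -/
structure IsCondenser (E F : Set X) : Prop where
  left : IsContinuum E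
  right : IsContinuum F
  disjoint : Disjoint E F

/-- `(X, μ)` is `Q`-Ahlfors regular with constant `A`: closed balls of radius `R ≤ diam X`
have measure between `A⁻¹ R^Q` and `A R^Q`. -/
def AhlforsRegular [MeasurableSpace X] (μ : Measure X) (Q A : ℝ) : Prop :=
  ∀ (x : X) (R : ℝ), 0 < R → R ≤ Metric.diam (univ : Set X) →
    ENNReal.ofReal (A⁻¹ * R ^ Q) ≤ μ (Metric.closedBall x R) ∧
      μ (Metric.closedBall x R) ≤ ENNReal.ofReal (A * R ^ Q)

end Analytic

/-! ### Combinatorial modulus in a graph -/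

section Graph

variable {V : Type*}

/-- The `ρ`-length `∑_{s ∈ K} ρ(s)` of a set `K` of vertices. -/
def graphLength (ρ : V → ℝ≥0) (K : Set V) : ℝ≥0∞ := ∑' s : K, (ρ s : ℝ≥0∞)

/-- The `Q`-volume `∑_s ρ(s)^Q` of a weight. -/
def graphVolume (Q : ℝ) (ρ : V → ℝ≥0) : ℝ≥0∞ := ∑' s : V, (ρ s : ℝ≥0∞) ^ Q

/-- `Q`-admissible weights on the vertices: those with `0 < ∑_s ρ(s)^Q < ∞`. -/
def IsWeight (Q : ℝ) (ρ : V → ℝ≥0) : Prop :=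
  0 < graphVolume Q ρ ∧ graphVolume Q ρ < ∞

/-- `L_ρ(Γ) = inf_{γ ∈ Γ} ℓ_ρ(γ)`, for a family `Γ` of subgraphs. -/
def graphInfLength {G : SimpleGraph V} (ρ : V → ℝ≥0) (Γ : Set G.Subgraph) : ℝ≥0∞ :=
  ⨅ γ ∈ Γ, graphLength ρ γ.verts

/-- The combinatorial `Q`-modulus `inf_ρ V_Q(ρ) / L_ρ(Γ)^Q` of a family `Γ` of subgraphs, the
quotient being `+∞` if `L_ρ(Γ) = 0`, and `0` if `L_ρ(Γ) = +∞` (e.g. for the empty family). -/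
def graphModulus (G : SimpleGraph V) (Q : ℝ) (Γ : Set G.Subgraph) : ℝ≥0∞ :=
  ⨅ (ρ : V → ℝ≥0) (_ : IsWeight Q ρ), graphVolume Q ρ / graphInfLength ρ Γ ^ Q

end Graph

/-! ### Covers, nerves, quasi-packings -/

section Cover

variable {X : Type*} [MetricSpace X]

/-- The nerve of a family of pieces: the vertices are the pieces, and the edges are the pairs of
distinct pieces that intersect. -/
def nerve (S : Set (Set X)) : SimpleGraph S where
  Adj s t := s ≠ t ∧ ((s : Set X) ∩ (t : Set X)).Nonempty
  symm := ⟨fun _ _ h => ⟨h.1.symm, by rw [inter_comm]; exact h.2⟩⟩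
  loopless := ⟨fun _ h => h.1 rfl⟩

/-- `S(K)`: the pieces of `S` that meet `K`. -/
def piecesMeeting (S : Set (Set X)) (K : Set X) : Set S :=
  {s | ((s : Set X) ∩ K).Nonempty}

/-- The subgraph of the nerve associated with a curve `γ`: its vertices are the pieces that meet
`γ`, with all the edges of the nerve between them. -/
def curveTrace (S : Set (Set X)) (γ : Curve X) : (nerve S).Subgraph :=
  (⊤ : (nerve S).Subgraph).induce (piecesMeeting S (range γ))

/-- The combinatorial modulus of a family of curves of `X` with respect to a cover `S`. -/
def combModulus (Q : ℝ) (S : Set (Set X)) (Γ : Set (Curve X)) : ℝ≥0∞ :=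
  graphModulus (nerve S) Q (curveTrace S '' Γ)

/-- The mesh of `S`: the supremum of the diameters of its pieces. -/
def mesh (S : Set (Set X)) : ℝ≥0∞ := ⨆ s ∈ S, Metric.ediam s

/-- `S` is a `K`-quasi-packing of `X`: a locally finite cover whose pieces are, up to the
factor `K`, round around inner balls, each inner ball meeting at most `K` inner balls of other
pieces. -/
structure IsQuasiPacking (K : ℝ) (S : Set (Set X)) : Prop where
  cover : ⋃₀ S = univ
  locallyFinite : LocallyFinite (fun s : S => (s : Set X))
  exists_balls : ∃ (x : S → X) (r : S → ℝ), (∀ s : S, x s ∈ (s : Set X)) ∧ (∀ s : S, 0 < r s) ∧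
    (∀ s : S, Metric.closedBall (x s) (r s) ⊆ (s : Set X) ∧
      (s : Set X) ⊆ Metric.closedBall (x s) (K * r s)) ∧
    ∀ s : S, {s' : S | s' ≠ s ∧ (Metric.closedBall (x s) (r s) ∩
        Metric.closedBall (x s') (r s')).Nonempty}.Finite ∧
      ({s' : S | s' ≠ s ∧ (Metric.closedBall (x s) (r s) ∩
        Metric.closedBall (x s') (r s')).Nonempty}.ncard : ℝ) ≤ K

end Cover

/-- `combModulus` along the sequence `S n` discretizes `modulus` on `Γ` up to the factor `C`:
if `mod_Q Γ > 0`, the two are comparable with constant `C` for all large `n`; if `mod_Q Γ = 0`,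
the combinatorial moduli tend to `0`. -/
def ModulusDiscretized {X : Type*} [MetricSpace X] [MeasurableSpace X] (μ : Measure X) (Q : ℝ)
    (C : ℝ≥0) (S : ℕ → Set (Set X)) (Γ : Set (Curve X)) : Prop :=
  (0 < modulus μ Q Γ → ∀ᶠ n in atTop,
    modulus μ Q Γ ≤ C * combModulus Q (S n) Γ ∧ combModulus Q (S n) Γ ≤ C * modulus μ Q Γ) ∧
  (modulus μ Q Γ = 0 → Tendsto (fun n => combModulus Q (S n) Γ) atTop (𝓝 0))

end CombMod

end

/-!
Both inequalities hold for any family `Γ` of curves described by a closed set of pairs of end points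
at distances bounded away from `0` (`IsEndpointSet`), which covers the curves of diameter at least
`L` as well as those that join two disjoint continua. Ahlfors regularity shows that the radii `r_s`
of the inner balls `B(x_s, r_s)` tend to `0` with the mesh (`eventually_exists_isRoundCover`), so
that only fine covers by finitely many pieces matter. All constants depend on `Q`, `A`, `K` alone.

*From pieces to functions* (`modulus_le_mul_combModulus`). Let `ρ` be a weight on the pieces, of
combinatorial length `L`. The function `∑ ρ(s) / (L K r_s) 1_{B(x_s, 2 K r_s)}` is admissible: a
curve that meets `s` leaves `B(x_s, 2 K r_s)`, hence has length at least `K r_s` inside. The large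
balls may overlap a lot, as the pieces can have very different sizes. But the `L^Q` norm of the sum
is comparable to that of the sum over the small balls `B(x_s, r_s)`, which have bounded overlap:
this is dual to the maximal theorem (`lintegral_sum_indicator_closedBall_mul_rpow_le`).
The maximal theorem is proved here for finite families of balls only, from Vitali's covering theorem
and the layer-cake formula (`lintegral_ballMaximal_rpow_le`).

*From functions to pieces* (`eventually_combModulus_le`). By the Vitali–Carathéodory theorem, an
admissible function `ρ` may be taken lower semicontinuous and bounded below by some `δ > 0`. The
piece `s` receives the weight `2 K r_s inf_s ρ`, whose `Q`-volume is at most a constant times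
`∫ ρ ^ Q`. The point is that, for fine covers, every curve of `Γ` has combinatorial length at least
`1 / 2` (`exists_half_le_graphLength`). A curve that violates this yields a chain of distinct pieces
from one end to the other (`exists_chain_of_isPreconnected`), whose total size is bounded thanks to
`δ`. If such chains existed at arbitrarily small scales, a subsequence would converge to a Lipschitz
curve of `Γ`, with line integral of `ρ` at most `1 / 2` by Fatou's lemma and lower semicontinuity
(`exists_curve_of_chains`), which contradicts admissibility. The comparison of line integrals with
integrals in an arbitrary parameter uses that arc length is a continuous function of the parameter
(`Rectifiable.range_arcLength`, `lineIntegral_le_of_lipschitzOnWith`).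
-/

namespace CombMod

/-! ### Arc length along curves -/

section ArcLength

variable {X : Type*} [MetricSpace X]

/-- The length of the initial piece of a curve `γ`, as a function of its end point. -/
noncomputable def arcLength (γ : Curve X) : unitInterval → ℝ :=
  variationOnFromTo (γ : unitInterval → X) univ 0

variable {γ : Curve X}

theorem Rectifiable.locallyBoundedVariationOn (hγ : Rectifiable γ) :
    LocallyBoundedVariationOn (γ : unitInterval → X) univ :=
  BoundedVariationOn.locallyBoundedVariationOn hγ

theorem Rectifiable.continuous_arcLength (hγ : Rectifiable γ) : Continuous (arcLength γ) := by
  refine continuous_iff_continuousAt.2 fun b ↦ continuousAt_iff_continuous_left'_right'.2 ⟨?_, ?_⟩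
  · have h := variationOnFromTo.tendsto_left (a := (0 : unitInterval)) (b := b) (mem_univ _)
      (mem_univ _) hγ.locallyBoundedVariationOn (γ.continuous.continuousAt.mono_left inf_le_left)
    simpa [ContinuousWithinAt, arcLength] using h
  · have h := variationOnFromTo.tendsto_right (a := (0 : unitInterval)) (b := b) (mem_univ _)
      (mem_univ _) hγ.locallyBoundedVariationOn (γ.continuous.continuousAt.mono_left inf_le_left)
    simpa [ContinuousWithinAt, arcLength] using h

theorem Rectifiable.monotone_arcLength (hγ : Rectifiable γ) : Monotone (arcLength γ) :=
  monotoneOn_univ.1 (variationOnFromTo.monotoneOn hγ.locallyBoundedVariationOn (mem_univ _))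

theorem arcLength_zero : arcLength γ 0 = 0 := variationOnFromTo.self _ _ _

theorem arcLength_one : arcLength γ 1 = (curveLength γ).toReal := by
  have h : univ ∩ Icc (0 : unitInterval) 1 = univ := by
    rw [univ_inter]; exact Icc_bot_top
  rw [arcLength, variationOnFromTo.eq_of_le _ _ zero_le_one, h, curveLength]

/-- Every length between `0` and the total length of the curve is attained: this is where the
continuity of the curve enters. -/
theorem Rectifiable.range_arcLength (hγ : Rectifiable γ) :
    range (arcLength γ) = Icc 0 (curveLength γ).toReal := by
  rw [← arcLength_zero (γ := γ), ← arcLength_one (γ := γ)]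
  refine subset_antisymm ?_ ?_
  · rintro _ ⟨b, rfl⟩
    exact ⟨hγ.monotone_arcLength unitInterval.nonneg', hγ.monotone_arcLength unitInterval.le_one'⟩
  · exact intermediate_value_univ _ _ hγ.continuous_arcLength

theorem Rectifiable.arcLengthParam_arcLength (hγ : Rectifiable γ) (b : unitInterval) :
    arcLengthParam γ (arcLength γ b) = γ b :=
  edist_eq_zero.1 <| edist_naturalParameterization_eq_zero hγ.locallyBoundedVariationOn
    (mem_univ _) (mem_univ b)

theorem Rectifiable.lipschitzOnWith_arcLengthParam (hγ : Rectifiable γ) :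
    LipschitzOnWith 1 (arcLengthParam γ) (Icc 0 (curveLength γ).toReal) := by
  have hu := has_unit_speed_naturalParameterization (γ : unitInterval → X)
    hγ.locallyBoundedVariationOn (mem_univ (0 : unitInterval))
  have hr := hγ.range_arcLength
  rw [← image_univ] at hr
  change variationOnFromTo (γ : unitInterval → X) univ 0 '' univ = _ at hr
  rw [hr] at hu
  intro x hx y hy
  wlog hxy : x ≤ y generalizing x y
  · rw [edist_comm, edist_comm x]
    exact this hy hx (le_of_not_ge hxy)
  have h := hu hx hy
  rw [ENNReal.coe_one, one_mul, edist_comm x y, edist_dist y x, Real.dist_eq,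
    abs_of_nonneg (sub_nonneg.2 hxy)]
  simp only [NNReal.coe_one, one_mul] at h
  rw [← h]
  exact eVariationOn.edist_le _ ⟨hx, le_rfl, hxy⟩ ⟨hy, hxy, le_rfl⟩

/-- The arc-length parametrization, extended to the real line by constants. -/
noncomputable def arcLengthParamExtend (γ : Curve X) : ℝ → X := fun t ↦
  arcLengthParam γ (projIcc 0 (curveLength γ).toReal ENNReal.toReal_nonneg t)

theorem arcLengthParamExtend_of_mem {t : ℝ} (ht : t ∈ Icc 0 (curveLength γ).toReal) :
    arcLengthParamExtend γ t = arcLengthParam γ t := by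
  rw [arcLengthParamExtend, projIcc_of_mem _ ht]

theorem Rectifiable.continuous_arcLengthParamExtend (hγ : Rectifiable γ) :
    Continuous (arcLengthParamExtend γ) :=
  (continuousOn_iff_continuous_domRestrict.1 hγ.lipschitzOnWith_arcLengthParam.continuousOn).comp
    continuous_projIcc

theorem lineIntegral_eq_extend (ρ : X → ℝ≥0∞) :
    lineIntegral ρ γ = ∫⁻ t in Icc (0 : ℝ) (curveLength γ).toReal, ρ (arcLengthParamExtend γ t) :=
  setLIntegral_congr_fun measurableSet_Icc fun t ht ↦ by rw [arcLengthParamExtend_of_mem ht]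

/-- A rectifiable curve which meets the ball `B(x, R)` and leaves the ball `B(x, 2R)` has length
at least `R` inside the latter. -/
theorem Rectifiable.ofReal_le_volume_preimage_closedBall (hγ : Rectifiable γ) {x : X} {R : ℝ}
    {b b' : unitInterval} (hb : dist (γ b) x ≤ R) (hb' : 2 * R < dist (γ b') x) :
    ENNReal.ofReal R ≤ volume (Icc 0 (curveLength γ).toReal ∩
      arcLengthParamExtend γ ⁻¹' Metric.closedBall x (2 * R)) := by
  have hmem : ∀ c, arcLength γ c ∈ Icc 0 (curveLength γ).toReal := fun c ↦
    hγ.range_arcLength ▸ mem_range_self c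
  have hlip : ∀ c, ∀ u ∈ Icc 0 (curveLength γ).toReal,
      dist (arcLengthParam γ u) (γ c) ≤ |u - arcLength γ c| := fun c u hu ↦ by
    have := hγ.lipschitzOnWith_arcLengthParam.dist_le_mul u hu _ (hmem c)
    rwa [hγ.arcLengthParam_arcLength, NNReal.coe_one, one_mul, Real.dist_eq] at this
  have hfar : R ≤ |arcLength γ b' - arcLength γ b| := by
    have h1 := hlip b _ (hmem b')
    rw [hγ.arcLengthParam_arcLength] at h1
    linarith [dist_triangle (γ b') (γ b) x]
  have key : ∀ u ∈ Icc 0 (curveLength γ).toReal, |u - arcLength γ b| ≤ R →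
      u ∈ Icc 0 (curveLength γ).toReal ∩
        arcLengthParamExtend γ ⁻¹' Metric.closedBall x (2 * R) := fun u hu hR ↦ by
    refine ⟨hu, ?_⟩
    rw [mem_preimage, arcLengthParamExtend_of_mem hu, Metric.mem_closedBall]
    linarith [dist_triangle (arcLengthParam γ u) (γ b) x, hlip b u hu]
  have h0 := hmem b
  have h1 := hmem b'
  rcases le_abs.1 hfar with h | h
  · calc ENNReal.ofReal R = volume (Icc (arcLength γ b) (arcLength γ b + R)) := by simp
      _ ≤ _ := measure_mono fun u hu ↦ key u
        ⟨h0.1.trans hu.1, hu.2.trans (by linarith [h1.2])⟩ (abs_le.2 (by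
          constructor <;> linarith [hu.1, hu.2]))
  · calc ENNReal.ofReal R = volume (Icc (arcLength γ b - R) (arcLength γ b)) := by simp
      _ ≤ _ := measure_mono fun u hu ↦ key u
        ⟨le_trans (by linarith [h1.1]) hu.1, hu.2.trans h0.2⟩ (abs_le.2 (by
          constructor <;> linarith [hu.1, hu.2]))

section Lipschitz

variable {f : ℝ → X} {l : ℝ≥0}

theorem eVariationOn_le_of_lipschitzOnWith (hf : LipschitzOnWith l f (Icc 0 1))
    (hγ : ∀ t : unitInterval, γ t = f t) {a b : unitInterval} (hab : a ≤ b) :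
    eVariationOn (γ : unitInterval → X) (Icc a b) ≤ l * ENNReal.ofReal ((b : ℝ) - a) := by
  have h : (γ : unitInterval → X) = f ∘ ((↑) : unitInterval → ℝ) := funext hγ
  have hm : MonotoneOn ((↑) : unitInterval → ℝ) (Icc a b) := fun _ _ _ _ h ↦ h
  rw [h]
  refine (hf.comp_eVariationOn_le fun t _ ↦ t.2).trans ?_
  gcongr
  simpa using (hm.eVariationOn_eq (left_mem_Icc.2 hab) (right_mem_Icc.2 hab)).le

theorem rectifiable_of_lipschitzOnWith (hf : LipschitzOnWith l f (Icc 0 1))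
    (hγ : ∀ t : unitInterval, γ t = f t) : Rectifiable γ := by
  have h := eVariationOn_le_of_lipschitzOnWith hf hγ (a := 0) (b := 1) zero_le_one
  rw [show Icc (0 : unitInterval) 1 = univ from Icc_bot_top] at h
  exact ne_top_of_le_ne_top (ENNReal.mul_ne_top ENNReal.coe_ne_top ENNReal.ofReal_ne_top) h

/-- The line integral along an `l`-Lipschitz curve `f : [0,1] → X` is at most `l ∫_0^1 ρ ∘ f`.
The arc length is an `l`-Lipschitz function of the parameter, so that it multiplies Lebesgue
measure by at most `l`. -/
theorem lineIntegral_le_of_lipschitzOnWith [MeasurableSpace X] [BorelSpace X]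
    (hf : LipschitzOnWith l f (Icc 0 1)) (hγ : ∀ t : unitInterval, γ t = f t)
    {ρ : X → ℝ≥0∞} (hρ : Measurable ρ) :
    lineIntegral ρ γ ≤ l * ∫⁻ t in Icc (0 : ℝ) 1, ρ (f t) := by
  have hrect := rectifiable_of_lipschitzOnWith hf hγ
  set V : ℝ → ℝ := fun t ↦ arcLength γ (projIcc 0 1 zero_le_one t) with hV
  have hVcont : Continuous V := hrect.continuous_arcLength.comp continuous_projIcc
  have hVlip : LipschitzOnWith l V (Icc 0 1) := by
    refine LipschitzOnWith.of_le_add_mul _ fun s hs t ht ↦ ?_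
    simp only [hV, projIcc_of_mem _ hs, projIcc_of_mem _ ht]
    rcases le_total s t with hst | hst
    · exact (hrect.monotone_arcLength (show (⟨s, hs⟩ : unitInterval) ≤ ⟨t, ht⟩ from hst)).trans
        (le_add_of_nonneg_right (by positivity))
    · rw [← sub_le_iff_le_add', arcLength, variationOnFromTo.sub_right
        hrect.locallyBoundedVariationOn (mem_univ _) (mem_univ _) (mem_univ _),
        variationOnFromTo.eq_of_le _ _ (show (⟨t, ht⟩ : unitInterval) ≤ ⟨s, hs⟩ from hst),
        univ_inter]
      refine ENNReal.toReal_le_of_le_ofReal (by positivity)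
        ((eVariationOn_le_of_lipschitzOnWith hf hγ
          (show (⟨t, ht⟩ : unitInterval) ≤ ⟨s, hs⟩ from hst)).trans_eq ?_)
      rw [ENNReal.ofReal_mul l.coe_nonneg, ENNReal.ofReal_coe_nnreal, Real.dist_eq,
        abs_of_nonneg (sub_nonneg.2 hst)]
  have hmeas : volume.restrict (Icc 0 (curveLength γ).toReal) ≤
      (l : ℝ≥0∞) • (volume.restrict (Icc (0 : ℝ) 1)).map V := by
    refine Measure.le_iff.2 fun B hB ↦ ?_
    rw [Measure.restrict_apply hB, Measure.smul_apply, Measure.map_apply hVcont.measurable hB,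
      Measure.restrict_apply (hVcont.measurable hB), smul_eq_mul]
    have hsub : B ∩ Icc 0 (curveLength γ).toReal ⊆ V '' (V ⁻¹' B ∩ Icc 0 1) := by
      rintro u ⟨huB, hu⟩
      rw [← hrect.range_arcLength] at hu
      obtain ⟨b, rfl⟩ := hu
      have hb : V b = arcLength γ b := by simp only [hV, projIcc_val]
      exact ⟨b, ⟨by rwa [mem_preimage, hb], b.2⟩, hb⟩
    refine (measure_mono hsub).trans ?_
    have := (hVlip.mono (inter_subset_right (s := V ⁻¹' B))).hausdorffMeasure_image_le
      (d := 1) zero_le_one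
    rwa [hausdorffMeasure_real, ENNReal.rpow_one] at this
  rw [lineIntegral_eq_extend]
  refine (lintegral_mono' hmeas le_rfl).trans_eq ?_
  rw [lintegral_smul_measure, smul_eq_mul, lintegral_map
    (f := fun u ↦ ρ (arcLengthParamExtend γ u))
    (hρ.comp hrect.continuous_arcLengthParamExtend.measurable) hVcont.measurable]
  congr 1
  refine setLIntegral_congr_fun measurableSet_Icc fun t ht ↦ ?_
  have hmem : V t ∈ Icc 0 (curveLength γ).toReal := hrect.range_arcLength ▸ mem_range_self _
  change ρ (arcLengthParamExtend γ (V t)) = ρ (f t)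
  rw [arcLengthParamExtend_of_mem hmem, hV, hrect.arcLengthParam_arcLength, hγ,
    projIcc_of_mem _ ht]

end Lipschitz

end ArcLength

/-! ### The maximal function of a finite family of balls -/

section Maximal

variable {X ι : Type*} [MetricSpace X] [MeasurableSpace X] {μ : Measure X}

/-- The weak-type estimate behind the maximal theorem, from Vitali's covering theorem. -/
theorem mul_measure_biUnion_closedBall_le [BorelSpace X] [Fintype ι]
    {x : ι → X} {R : ι → ℝ} {c : ℝ≥0}
    (hc : ∀ i, μ (Metric.closedBall (x i) (5 * R i)) ≤ c * μ (Metric.closedBall (x i) (R i)))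
    {ψ : X → ℝ≥0∞} {t : ℝ≥0∞} {T : Set ι}
    (hT : ∀ i ∈ T, t * μ (Metric.closedBall (x i) (R i)) ≤
      ∫⁻ y in Metric.closedBall (x i) (R i), ψ y ∂μ) :
    t * μ (⋃ i ∈ T, Metric.closedBall (x i) (R i)) ≤ c * ∫⁻ y, ψ y ∂μ := by
  obtain ⟨u, huT, hdisj, hcov⟩ := Vitali.exists_disjoint_subfamily_covering_enlargement_closedBall
    T x R (∑ i, |R i|) (fun i _ ↦ (le_abs_self _).trans
      (Finset.single_le_sum (f := fun i ↦ |R i|) (fun _ _ ↦ abs_nonneg _) (Finset.mem_univ i)))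
    5 (by norm_num)
  have hu : u.Countable := u.to_countable
  have hsub : (⋃ i ∈ T, Metric.closedBall (x i) (R i)) ⊆
      ⋃ i ∈ u, Metric.closedBall (x i) (5 * R i) := by
    refine iUnion₂_subset fun i hi ↦ ?_
    obtain ⟨b, hb, hib⟩ := hcov i hi
    exact hib.trans (subset_biUnion_of_mem (u := fun i ↦ Metric.closedBall (x i) (5 * R i)) hb)
  calc t * μ (⋃ i ∈ T, Metric.closedBall (x i) (R i))
      ≤ t * ∑' i : u, μ (Metric.closedBall (x i) (5 * R i)) := by
        gcongr
        exact (measure_mono hsub).trans (measure_biUnion_le μ hu _)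
    _ ≤ t * ∑' i : u, c * μ (Metric.closedBall (x i) (R i)) := by
        gcongr with i
        exact hc i
    _ = c * ∑' i : u, t * μ (Metric.closedBall (x i) (R i)) := by
        rw [ENNReal.tsum_mul_left, ENNReal.tsum_mul_left, mul_left_comm]
    _ ≤ c * ∑' i : u, ∫⁻ y in Metric.closedBall (x i) (R i), ψ y ∂μ := by
        gcongr with i
        exact hT i (huT i.2)
    _ = c * ∫⁻ y in ⋃ i ∈ u, Metric.closedBall (x i) (R i), ψ y ∂μ := by
        rw [lintegral_biUnion hu (fun _ _ ↦ Metric.isClosed_closedBall.measurableSet) hdisj]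
    _ ≤ c * ∫⁻ y, ψ y ∂μ := by
        gcongr
        exact Measure.restrict_le_self

/-- The average of `φ` over the `i`-th ball of a family. -/
noncomputable def ballAverage (μ : Measure X) (x : ι → X) (R : ι → ℝ) (φ : X → ℝ≥0) (i : ι) :
    ℝ≥0 :=
  ((∫⁻ y in Metric.closedBall (x i) (R i), φ y ∂μ) / μ (Metric.closedBall (x i) (R i))).toNNReal

/-- The maximal function of `φ` relative to a finite family of balls: at a point `y`, the largest
average of `φ` over the balls of the family that contain `y`. -/
noncomputable def ballMaximal [Fintype ι] (μ : Measure X) (x : ι → X) (R : ι → ℝ) (φ : X → ℝ≥0)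
    (y : X) : ℝ≥0 :=
  Finset.univ.sup fun i ↦
    (Metric.closedBall (x i) (R i)).indicator (fun _ ↦ ballAverage μ x R φ i) y

theorem measurable_ballMaximal [BorelSpace X] [Fintype ι] (x : ι → X) (R : ι → ℝ) (φ : X → ℝ≥0) :
    Measurable (ballMaximal μ x R φ) := by
  have h : ballMaximal μ x R φ = fun y ↦ ⨆ i,
      (Metric.closedBall (x i) (R i)).indicator (fun _ ↦ ballAverage μ x R φ i) y := by
    funext y
    rw [ballMaximal, Finset.sup_univ_eq_ciSup]
  rw [h]
  exact Measurable.iSup fun i ↦ measurable_const.indicator Metric.isClosed_closedBall.measurableSet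

theorem ballAverage_le_ballMaximal [Fintype ι] {x : ι → X} {R : ι → ℝ} (φ : X → ℝ≥0) {i : ι} {y : X}
    (hy : y ∈ Metric.closedBall (x i) (R i)) :
    ballAverage μ x R φ i ≤ ballMaximal μ x R φ y := by
  have := Finset.le_sup (f := fun i ↦
    (Metric.closedBall (x i) (R i)).indicator (fun _ ↦ ballAverage μ x R φ i) y)
    (Finset.mem_univ i)
  rwa [indicator_of_mem hy] at this

theorem ballAverage_mul_measure [IsFiniteMeasure μ] {x : ι → X} {R : ι → ℝ} {φ : X → ℝ≥0}
    (h0 : ∀ i, μ (Metric.closedBall (x i) (R i)) ≠ 0) (hφ : ∫⁻ y, φ y ∂μ ≠ ∞) (i : ι) :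
    ballAverage μ x R φ i * μ (Metric.closedBall (x i) (R i)) =
      ∫⁻ y in Metric.closedBall (x i) (R i), φ y ∂μ := by
  have hi : ∫⁻ y in Metric.closedBall (x i) (R i), φ y ∂μ ≠ ∞ :=
    ne_top_of_le_ne_top hφ (setLIntegral_le_lintegral _ _)
  rw [ballAverage, ENNReal.coe_toNNReal (ENNReal.div_ne_top hi (h0 i)),
    ENNReal.div_mul_cancel (h0 i) (measure_ne_top _ _)]

/-- The weak-type estimate at height `t`, applied to the part of `φ` above `t / 2`. -/
theorem mul_measure_lt_ballMaximal_le [BorelSpace X] [IsFiniteMeasure μ] [Fintype ι]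
    {x : ι → X} {R : ι → ℝ} {c : ℝ≥0}
    (hc : ∀ i, μ (Metric.closedBall (x i) (5 * R i)) ≤ c * μ (Metric.closedBall (x i) (R i)))
    (h0 : ∀ i, μ (Metric.closedBall (x i) (R i)) ≠ 0) {φ : X → ℝ≥0} (hφm : Measurable φ)
    (hφ : ∫⁻ y, φ y ∂μ ≠ ∞) (t : ℝ≥0) :
    t * μ {y | t < ballMaximal μ x R φ y} ≤
      2 * c * μ.withDensity (fun y ↦ (φ y : ℝ≥0∞)) {y | t < 2 * φ y} := by
  set E : Set X := {y | t < 2 * φ y} with hE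
  have hEm : MeasurableSet E := measurableSet_lt measurable_const (hφm.const_mul 2)
  have hdens : μ.withDensity (fun y ↦ (φ y : ℝ≥0∞)) E = ∫⁻ y, E.indicator (fun y ↦ φ y) y ∂μ := by
    rw [withDensity_apply _ hEm, lintegral_indicator hEm]
  have hsub : {y | t < ballMaximal μ x R φ y} ⊆
      ⋃ i ∈ {i | t < ballAverage μ x R φ i}, Metric.closedBall (x i) (R i) := by
    intro y hy
    obtain ⟨i, -, hi⟩ := (Finset.lt_sup_iff).1 (show t < Finset.univ.sup _ from hy)
    by_cases hyi : y ∈ Metric.closedBall (x i) (R i)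
    · rw [indicator_of_mem hyi] at hi
      exact mem_biUnion (x := i) hi hyi
    · rw [indicator_of_notMem hyi] at hi
      exact absurd hi not_lt_zero
  have key : ∀ i ∈ {i | t < ballAverage μ x R φ i},
      ((t / 2 : ℝ≥0) : ℝ≥0∞) * μ (Metric.closedBall (x i) (R i)) ≤
        ∫⁻ y in Metric.closedBall (x i) (R i), E.indicator (fun y ↦ (φ y : ℝ≥0∞)) y ∂μ := by
    intro i hi
    set D := Metric.closedBall (x i) (R i)
    have hfin : ((t / 2 : ℝ≥0) : ℝ≥0∞) * μ D ≠ ∞ :=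
      ENNReal.mul_ne_top ENNReal.coe_ne_top (measure_ne_top _ _)
    refine (ENNReal.add_le_add_iff_left hfin).1 ?_
    calc ((t / 2 : ℝ≥0) : ℝ≥0∞) * μ D + ((t / 2 : ℝ≥0) : ℝ≥0∞) * μ D = t * μ D := by
          rw [← add_mul, ← ENNReal.coe_add, add_halves]
      _ ≤ ballAverage μ x R φ i * μ D := by
          gcongr
          exact le_of_lt hi
      _ = ∫⁻ y in D, φ y ∂μ := ballAverage_mul_measure h0 hφ i
      _ ≤ ∫⁻ y in D, ((t / 2 : ℝ≥0) : ℝ≥0∞) + E.indicator (fun y ↦ (φ y : ℝ≥0∞)) y ∂μ := by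
          gcongr with y
          by_cases hy : y ∈ E
          · rw [indicator_of_mem hy]
            exact le_add_self
          · rw [indicator_of_notMem hy, add_zero, ENNReal.coe_le_coe,
              le_div_iff₀ (by norm_num), mul_comm]
            exact not_lt.1 hy
      _ = _ := by
          rw [lintegral_add_left measurable_const, setLIntegral_const]
  calc (t : ℝ≥0∞) * μ {y | t < ballMaximal μ x R φ y}
      ≤ t * μ (⋃ i ∈ {i | t < ballAverage μ x R φ i}, Metric.closedBall (x i) (R i)) := by
        gcongr
    _ = 2 * (((t / 2 : ℝ≥0) : ℝ≥0∞) *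
          μ (⋃ i ∈ {i | t < ballAverage μ x R φ i}, Metric.closedBall (x i) (R i))) := by
        rw [← mul_assoc]
        congr 1
        rw [← ENNReal.coe_ofNat, ← ENNReal.coe_mul, mul_div_cancel₀ _ two_ne_zero]
    _ ≤ 2 * (c * ∫⁻ y, E.indicator (fun y ↦ (φ y : ℝ≥0∞)) y ∂μ) := by
        exact mul_le_mul_right (mul_measure_biUnion_closedBall_le hc key) _
    _ = _ := by rw [hdens, mul_assoc]

/-- The `L^p` maximal theorem, `p > 1`, for a finite family of balls on which `μ` is doubling. -/
theorem lintegral_ballMaximal_rpow_le [BorelSpace X] [IsFiniteMeasure μ] [Fintype ι]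
    {x : ι → X} {R : ι → ℝ} {c : ℝ≥0}
    (hc : ∀ i, μ (Metric.closedBall (x i) (5 * R i)) ≤ c * μ (Metric.closedBall (x i) (R i)))
    (h0 : ∀ i, μ (Metric.closedBall (x i) (R i)) ≠ 0) {φ : X → ℝ≥0} (hφm : Measurable φ)
    (hφ : ∫⁻ y, φ y ∂μ ≠ ∞) {p : ℝ} (hp : 1 < p) :
    ∫⁻ y, (ballMaximal μ x R φ y : ℝ≥0∞) ^ p ∂μ ≤
      ENNReal.ofReal (2 ^ p * p / (p - 1)) * c * ∫⁻ y, (φ y : ℝ≥0∞) ^ p ∂μ := by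
  have hp0 : 0 < p := one_pos.trans hp
  have hp1 : 0 < p - 1 := sub_pos.2 hp
  set ν := μ.withDensity (fun y ↦ (φ y : ℝ≥0∞)) with hν
  have hφe : Measurable fun y ↦ (φ y : ℝ≥0∞) := hφm.coe_nnreal_ennreal
  have hM : ∫⁻ y, (ballMaximal μ x R φ y : ℝ≥0∞) ^ p ∂μ =
      ∫⁻ y, ENNReal.ofReal ((ballMaximal μ x R φ y : ℝ) ^ p) ∂μ := by
    congr 1 with y
    rw [← ENNReal.ofReal_rpow_of_nonneg (NNReal.coe_nonneg _) hp0.le, ENNReal.ofReal_coe_nnreal]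
  have hΦ : ∫⁻ y, ENNReal.ofReal (((2 * φ y : ℝ≥0) : ℝ) ^ (p - 1)) ∂ν =
      ENNReal.ofReal (2 ^ (p - 1)) * ∫⁻ y, (φ y : ℝ≥0∞) ^ p ∂μ := by
    rw [hν, lintegral_withDensity_eq_lintegral_mul _ hφe (by fun_prop),
      ← lintegral_const_mul _ (hφe.pow_const _)]
    congr 1 with y
    rw [Pi.mul_apply, NNReal.coe_mul, Real.mul_rpow (by positivity) (by positivity),
      ENNReal.ofReal_mul (by positivity), mul_left_comm, NNReal.coe_ofNat]
    congr 1
    rw [← ENNReal.ofReal_rpow_of_nonneg (NNReal.coe_nonneg _) hp1.le, ENNReal.ofReal_coe_nnreal]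
    nth_rw 1 [← ENNReal.rpow_one (φ y : ℝ≥0∞)]
    rw [← ENNReal.rpow_add_of_nonneg _ _ zero_le_one hp1.le, add_sub_cancel]
  rw [hM, lintegral_rpow_eq_lintegral_meas_lt_mul μ (ae_of_all _ fun _ ↦ NNReal.coe_nonneg _)
    (measurable_ballMaximal x R φ).coe_nnreal_real.aemeasurable hp0]
  have hlc := lintegral_rpow_eq_lintegral_meas_lt_mul ν (f := fun y ↦ ((2 * φ y : ℝ≥0) : ℝ))
    (ae_of_all _ fun _ ↦ NNReal.coe_nonneg _)
    (hφm.const_mul 2).coe_nnreal_real.aemeasurable hp1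
  have hle : ∫⁻ t in Ioi (0 : ℝ), μ {a | t < ballMaximal μ x R φ a} * ENNReal.ofReal (t ^ (p - 1)) ≤
      2 * c * ∫⁻ t in Ioi (0 : ℝ), ν {a | t < ((2 * φ a : ℝ≥0) : ℝ)} *
        ENNReal.ofReal (t ^ (p - 1 - 1)) := by
    rw [← lintegral_const_mul']
    · refine setLIntegral_mono' measurableSet_Ioi fun t ht ↦ ?_
      lift t to ℝ≥0 using le_of_lt ht
      have ht0 : 0 < (t : ℝ) := ht
      have hw := mul_measure_lt_ballMaximal_le hc h0 hφm hφ t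
      simp only [NNReal.coe_lt_coe]
      rw [show (t : ℝ) ^ (p - 1) = t * (t : ℝ) ^ (p - 1 - 1) by
        rw [← Real.rpow_one_add' ht0.le (by linarith)]; congr 1; ring,
        ENNReal.ofReal_mul ht0.le, ENNReal.ofReal_coe_nnreal, ← mul_assoc, ← mul_assoc,
        mul_comm (μ _)]
      gcongr
    · exact ENNReal.mul_ne_top ENNReal.ofNat_ne_top ENNReal.coe_ne_top
  have hlc' : ∫⁻ t in Ioi (0 : ℝ), ν {a | t < ((2 * φ a : ℝ≥0) : ℝ)} *
      ENNReal.ofReal (t ^ (p - 1 - 1)) =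
      ENNReal.ofReal (2 ^ (p - 1) / (p - 1)) * ∫⁻ y, (φ y : ℝ≥0∞) ^ p ∂μ := by
    rw [ENNReal.ofReal_div_of_pos hp1, ENNReal.mul_div_right_comm.symm, ← hΦ]
    exact (ENNReal.eq_div_iff (ENNReal.ofReal_pos.2 hp1).ne' ENNReal.ofReal_ne_top).2 hlc.symm
  refine (mul_le_mul_right hle _).trans_eq ?_
  rw [hlc', ← mul_assoc, ← mul_assoc]
  congr 1
  rw [← mul_assoc, mul_right_comm _ (c : ℝ≥0∞), ← ENNReal.ofReal_ofNat 2,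
    ← ENNReal.ofReal_mul hp0.le, ← ENNReal.ofReal_mul (by positivity)]
  congr 2
  rw [Real.rpow_sub_one two_ne_zero]
  ring

end Maximal

/-! ### Enlarging the balls of a weighted sum -/

section Enlarge

variable {X ι : Type*} [MetricSpace X] [MeasurableSpace X] {μ : Measure X}

/-- The constant, for norms, in `lintegral_sum_indicator_closedBall_mul_rpow_le`. -/
noncomputable def enlargeConst (Q : ℝ) (c : ℝ≥0) : ℝ≥0 :=
  c * (Real.toNNReal (2 ^ Q.conjExponent * Q.conjExponent / (Q.conjExponent - 1)) * c) ^
    (1 / Q.conjExponent)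

/-- Enlarging the balls of a weighted sum of indicator functions increases its `L^Q` norm by at
most a constant factor. By duality with the maximal theorem: paired with the function `g ^ (Q - 1)`,
`g` being the sum over the large balls, the large balls may be replaced by the small ones provided
that `g ^ (Q - 1)` is replaced by its maximal function. -/
theorem lintegral_sum_indicator_closedBall_mul_rpow_le [BorelSpace X] [IsFiniteMeasure μ]
    [Fintype ι] {x : ι → X} {r : ι → ℝ} {Λ Q : ℝ} (hQ : 1 < Q) {c : ℝ≥0} (hΛ : 1 ≤ Λ)
    (hr : ∀ i, 0 < r i)
    (hc : ∀ i, μ (Metric.closedBall (x i) (5 * (Λ * r i))) ≤ c * μ (Metric.closedBall (x i) (r i)))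
    (h0 : ∀ i, μ (Metric.closedBall (x i) (r i)) ≠ 0) (a : ι → ℝ≥0) :
    ∫⁻ y, (∑ i, (Metric.closedBall (x i) (Λ * r i)).indicator (fun _ ↦ (a i : ℝ≥0∞)) y) ^ Q ∂μ ≤
      (enlargeConst Q c : ℝ≥0∞) ^ Q *
        ∫⁻ y, (∑ i, (Metric.closedBall (x i) (r i)).indicator (fun _ ↦ (a i : ℝ≥0∞)) y) ^ Q ∂μ := by
  have hQ0 : 0 < Q := one_pos.trans hQ
  have hpq : Q.HolderConjugate Q.conjExponent := Real.HolderConjugate.conjExponent hQ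
  set p := Q.conjExponent with hp
  have hr1 : ∀ i, r i ≤ Λ * r i := fun i ↦ le_mul_of_one_le_left (hr i).le hΛ
  have hsub : ∀ i, Metric.closedBall (x i) (r i) ⊆ Metric.closedBall (x i) (Λ * r i) := fun i ↦
    Metric.closedBall_subset_closedBall (hr1 i)
  have hsub' : ∀ i, Metric.closedBall (x i) (Λ * r i) ⊆ Metric.closedBall (x i) (5 * (Λ * r i)) :=
    fun i ↦ Metric.closedBall_subset_closedBall (by linarith [hr i, hr1 i])
  have hD : ∀ i, μ (Metric.closedBall (x i) (Λ * r i)) ≠ 0 := fun i h ↦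
    h0 i (measure_mono_null (hsub i) h)
  have hD5 : ∀ i, μ (Metric.closedBall (x i) (5 * (Λ * r i))) ≤
      c * μ (Metric.closedBall (x i) (Λ * r i)) := fun i ↦ (hc i).trans <| by
    gcongr
    exact hr1 i
  have hDm : ∀ i, MeasurableSet (Metric.closedBall (x i) (Λ * r i)) := fun i ↦
    Metric.isClosed_closedBall.measurableSet
  have hBm : ∀ i, MeasurableSet (Metric.closedBall (x i) (r i)) := fun i ↦
    Metric.isClosed_closedBall.measurableSet
  -- the sums over the large balls and over the small balls, and the dual function
  set g : X → ℝ≥0 := fun y ↦ ∑ i, (Metric.closedBall (x i) (Λ * r i)).indicator (fun _ ↦ a i) y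
  set h : X → ℝ≥0∞ := fun y ↦
    ∑ i, (Metric.closedBall (x i) (r i)).indicator (fun _ ↦ (a i : ℝ≥0∞)) y
  have hgc : ∀ y, (g y : ℝ≥0∞) =
      ∑ i, (Metric.closedBall (x i) (Λ * r i)).indicator (fun _ ↦ (a i : ℝ≥0∞)) y := fun y ↦ by
    simp only [g, ENNReal.ofNNReal_finsetSum, ENNReal.coe_indicator]
  have hgm : Measurable g := Finset.measurable_sum _ fun i _ ↦ measurable_const.indicator (hDm i)
  have hhm : Measurable h := Finset.measurable_sum _ fun i _ ↦ measurable_const.indicator (hBm i)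
  have hg_le : ∀ y, g y ≤ ∑ i, a i := fun y ↦ Finset.sum_le_sum fun i _ ↦
    indicator_le_self' (fun _ _ ↦ zero_le) y
  set φ : X → ℝ≥0 := fun y ↦ g y ^ (Q - 1) with hφdef
  have hφm : Measurable φ := hgm.pow_const _
  have hfin : ∀ {f : X → ℝ≥0} (b : ℝ≥0), (∀ y, f y ≤ b) → ∫⁻ y, f y ∂μ ≠ ∞ := fun b hb ↦
    ne_top_of_le_ne_top (by simp [ENNReal.mul_ne_top])
      (lintegral_mono (g := fun _ ↦ (b : ℝ≥0∞)) fun y ↦ ENNReal.coe_le_coe.2 (hb y))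
  have hφ : ∫⁻ y, φ y ∂μ ≠ ∞ := hfin ((∑ i, a i) ^ (Q - 1)) fun y ↦
    NNReal.rpow_le_rpow (hg_le y) (by linarith)
  have hφp : ∀ y, (φ y : ℝ≥0∞) ^ p = (g y : ℝ≥0∞) ^ Q := fun y ↦ by
    rw [hφdef, ENNReal.coe_rpow_of_nonneg _ (by linarith), ← ENNReal.rpow_mul,
      hpq.sub_one_mul_conj]
  have hgQ : ∀ y, (g y : ℝ≥0∞) ^ Q = ∑ i,
      (Metric.closedBall (x i) (Λ * r i)).indicator (fun y ↦ (a i : ℝ≥0∞) * φ y) y := fun y ↦ by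
    have h1 : (φ y : ℝ≥0∞) = (g y : ℝ≥0∞) ^ (Q - 1) := ENNReal.coe_rpow_of_nonneg _ (by linarith)
    rw [← add_sub_cancel 1 Q, ENNReal.rpow_add_of_nonneg _ _ zero_le_one (by linarith),
      ENNReal.rpow_one, ← h1, hgc, Finset.sum_mul]
    exact Finset.sum_congr rfl fun i _ ↦ (indicator_mul_left _ (fun _ ↦ (a i : ℝ≥0∞))
        (fun y ↦ (φ y : ℝ≥0∞))).symm
  set M := ballMaximal μ x (fun i ↦ Λ * r i) φ with hM
  have hMm : Measurable M := measurable_ballMaximal _ _ _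
  set G := ∫⁻ y, (g y : ℝ≥0∞) ^ Q ∂μ with hG
  have hGfin : G ≠ ∞ := by
    have := hfin ((∑ i, a i) ^ Q) fun y ↦ NNReal.rpow_le_rpow (hg_le y) hQ0.le
    simpa only [ENNReal.coe_rpow_of_nonneg _ hQ0.le] using this
  have step : G ≤ c * ∫⁻ y, (h * fun y ↦ (M y : ℝ≥0∞)) y ∂μ := by
    calc G = ∑ i, a i * ∫⁻ y in Metric.closedBall (x i) (Λ * r i), φ y ∂μ := by
          simp only [hG, hgQ]
          rw [lintegral_finsetSum _ fun i _ ↦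
            (hφm.coe_nnreal_ennreal.const_mul _).indicator (hDm i)]
          congr 1 with i
          rw [lintegral_indicator (hDm i), lintegral_const_mul _ hφm.coe_nnreal_ennreal]
      _ ≤ ∑ i, a i * (c * ∫⁻ y in Metric.closedBall (x i) (r i), M y ∂μ) := by
          refine Finset.sum_le_sum fun i _ ↦ mul_le_mul_right ?_ _
          rw [← ballAverage_mul_measure (R := fun i ↦ Λ * r i) hD hφ]
          calc _ ≤ (ballAverage μ x (fun i ↦ Λ * r i) φ i : ℝ≥0∞) *
                (c * μ (Metric.closedBall (x i) (r i))) :=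
                mul_le_mul_right ((measure_mono (hsub' i)).trans (hc i)) _
            _ = c * ∫⁻ _ in Metric.closedBall (x i) (r i),
                (ballAverage μ x (fun i ↦ Λ * r i) φ i : ℝ≥0∞) ∂μ := by
                rw [setLIntegral_const, mul_left_comm]
            _ ≤ _ := by
                refine mul_le_mul_right (setLIntegral_mono' (hBm i) fun y hy ↦ ?_) _
                exact ENNReal.coe_le_coe.2 (ballAverage_le_ballMaximal (R := fun i ↦ Λ * r i) φ
                  (hsub i hy))
      _ = c * ∫⁻ y, (h * fun y ↦ (M y : ℝ≥0∞)) y ∂μ := by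
          have hhM : ∀ y, (h * fun y ↦ (M y : ℝ≥0∞)) y = ∑ i,
              (Metric.closedBall (x i) (r i)).indicator (fun y ↦ (a i : ℝ≥0∞) * M y) y := fun y ↦ by
            rw [Pi.mul_apply, Finset.sum_mul]
            exact Finset.sum_congr rfl fun i _ ↦ (indicator_mul_left _ (fun _ ↦ (a i : ℝ≥0∞))
              (fun y ↦ (M y : ℝ≥0∞))).symm
          simp only [hhM]
          rw [lintegral_finsetSum _ fun i _ ↦
            (hMm.coe_nnreal_ennreal.const_mul _).indicator (hBm i), Finset.mul_sum]
          congr 1 with i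
          rw [lintegral_indicator (hBm i), lintegral_const_mul _ hMm.coe_nnreal_ennreal,
            mul_left_comm]
  have hmax : ∫⁻ y, (M y : ℝ≥0∞) ^ p ∂μ ≤
      ENNReal.ofReal (2 ^ p * p / (p - 1)) * c * G := by
    have := lintegral_ballMaximal_rpow_le (R := fun i ↦ Λ * r i) hD5 hD hφm hφ hpq.symm.lt
    simpa only [hφp] using this
  have hp0 : 0 < 1 / p := by have := hpq.symm.pos; positivity
  have hholder : G ≤ enlargeConst Q c * (∫⁻ y, h y ^ Q ∂μ) ^ (1 / Q) * G ^ (1 / p) := by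
    refine step.trans ?_
    calc c * ∫⁻ y, (h * fun y ↦ (M y : ℝ≥0∞)) y ∂μ
        ≤ c * ((∫⁻ y, h y ^ Q ∂μ) ^ (1 / Q) *
          (ENNReal.ofReal (2 ^ p * p / (p - 1)) * c * G) ^ (1 / p)) := by
          refine mul_le_mul_right ?_ _
          refine (ENNReal.lintegral_mul_le_Lp_mul_Lq μ hpq hhm.aemeasurable
            hMm.coe_nnreal_ennreal.aemeasurable).trans ?_
          gcongr
      _ = _ := by
          rw [enlargeConst, ← hp, ENNReal.coe_mul, ENNReal.coe_rpow_of_nonneg _ hp0.le,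
            ENNReal.mul_rpow_of_nonneg _ G hp0.le, ENNReal.coe_mul, ENNReal.ofReal]
          ring
  have hfinal : G ≤ (enlargeConst Q c : ℝ≥0∞) ^ Q * ∫⁻ y, h y ^ Q ∂μ := by
    rcases eq_or_ne G 0 with hG0 | hG0
    · rw [hG0]; exact zero_le
    have hsplit : G = G ^ (1 / Q) * G ^ (1 / p) := by
      rw [← ENNReal.rpow_add _ _ hG0 hGfin, one_div, one_div, hpq.inv_add_inv_eq_one,
        ENNReal.rpow_one]
    have hGp0 : G ^ (1 / p) ≠ 0 := (ENNReal.rpow_pos (pos_iff_ne_zero.2 hG0) hGfin).ne'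
    have hGpt : G ^ (1 / p) ≠ ∞ := ENNReal.rpow_ne_top_of_nonneg hp0.le hGfin
    nth_rw 1 [hsplit] at hholder
    have h1 := (ENNReal.mul_le_mul_iff_left hGp0 hGpt).1 hholder
    have h2 := ENNReal.rpow_le_rpow h1 hQ0.le
    rwa [ENNReal.mul_rpow_of_nonneg _ _ hQ0.le, ← ENNReal.rpow_mul, ← ENNReal.rpow_mul,
      one_div_mul_cancel hQ0.ne', ENNReal.rpow_one, ENNReal.rpow_one] at h2
  simpa only [← hgc] using hfinal

/-- For balls with bounded overlap, the `L^Q` norm of a weighted sum of indicator functions is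
controlled term by term. -/
theorem lintegral_sum_indicator_rpow_le [BorelSpace X] [Fintype ι] {B : ι → Set X}
    (hB : ∀ i, MeasurableSet (B i)) {Q : ℝ} (hQ : 1 ≤ Q) {N : ℕ}
    (hN : ∀ y, {i | y ∈ B i}.ncard ≤ N) (a : ι → ℝ≥0) :
    ∫⁻ y, (∑ i, (B i).indicator (fun _ ↦ (a i : ℝ≥0∞)) y) ^ Q ∂μ ≤
      (N : ℝ≥0∞) ^ (Q - 1) * ∑ i, (a i : ℝ≥0∞) ^ Q * μ (B i) := by
  classical
  have hpt : ∀ y, (∑ i, (B i).indicator (fun _ ↦ (a i : ℝ≥0∞)) y) ^ Q ≤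
      (N : ℝ≥0∞) ^ (Q - 1) * ∑ i, (B i).indicator (fun _ ↦ (a i : ℝ≥0∞) ^ Q) y := fun y ↦ by
    have hsum : ∀ f : ι → ℝ≥0∞, ∑ i, (B i).indicator (fun _ ↦ f i) y =
        ∑ i ∈ Finset.univ.filter (fun i ↦ y ∈ B i), f i := fun f ↦ by
      simp only [indicator_apply, Finset.sum_filter]
    rw [hsum, hsum fun i ↦ (a i : ℝ≥0∞) ^ Q]
    have hcard : (Finset.univ.filter fun i ↦ y ∈ B i).card ≤ N := by
      rw [← ncard_coe_finset]
      simpa using hN y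
    refine (ENNReal.rpow_sum_le_const_mul_sum_rpow _ _ hQ).trans ?_
    gcongr
  refine (lintegral_mono hpt).trans_eq ?_
  rw [lintegral_const_mul _ (Finset.measurable_sum _ fun i _ ↦ measurable_const.indicator (hB i)),
    lintegral_finsetSum _ fun i _ ↦ measurable_const.indicator (hB i)]
  simp only [lintegral_indicator_const (hB _)]

end Enlarge

/-! ### Limits of discrete chains -/

section Chains

variable {X : Type*} [MetricSpace X]

/-- A finite chain of points `y 0, …, y N` whose `i`-th step has size at most `a i` is traversed at
constant speed by a step function `f` on `[0, 1]`, which is Lipschitz up to an error of one step.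
A weight `m i` carried by the `i`-th step becomes a step function `g`. -/
theorem exists_step_parametrization {y : ℕ → X} {a : ℕ → ℝ} {m : ℕ → ℝ≥0∞} {N : ℕ} {η : ℝ}
    (hN : 0 < N) (ha : ∀ i, 0 < a i) (haη : ∀ i, a i ≤ η)
    (hd : ∀ i < N, dist (y i) (y (i + 1)) ≤ a i) :
    ∃ (f : ℝ → X) (g : ℝ → ℝ≥0∞), Measurable g ∧ f 0 = y 0 ∧ f 1 = y N ∧
      (∀ s ∈ Icc (0 : ℝ) 1, ∀ t ∈ Icc (0 : ℝ) 1,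
        dist (f s) (f t) ≤ (∑ i ∈ Finset.range N, a i) * |s - t| + η) ∧
      (∀ t ∈ Ico (0 : ℝ) 1, ∃ i < N, f t = y i ∧ m i ≤ g t) ∧
      ENNReal.ofReal (∑ i ∈ Finset.range N, a i) * ∫⁻ t, g t =
        ∑ i ∈ Finset.range N, ENNReal.ofReal (a i) * m i := by
  classical
  set A : ℕ → ℝ := fun k ↦ ∑ i ∈ Finset.range k, a i with hA
  have hA0 : A 0 = 0 := Finset.sum_range_zero _
  have hAs : ∀ k, A (k + 1) = A k + a k := fun k ↦ Finset.sum_range_succ _ _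
  have hAmono : StrictMono A := strictMono_nat_of_lt_succ fun k ↦ by rw [hAs]; linarith [ha k]
  set L := A N with hL
  have hLpos : 0 < L := hA0 ▸ hAmono hN
  -- the step reached at time `t`
  set idx : ℝ → ℕ := fun t ↦ Nat.findGreatest (fun i ↦ A i ≤ t * L) N with hidx
  have hidxN : ∀ t, idx t ≤ N := fun t ↦ Nat.findGreatest_le _
  have hidx_le : ∀ t, 0 ≤ t → A (idx t) ≤ t * L := fun t ht ↦
    Nat.findGreatest_spec (P := fun i ↦ A i ≤ t * L) (Nat.zero_le N)
      (by rw [hA0]; positivity)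
  have hidx_lt : ∀ t, idx t < N → t * L < A (idx t + 1) := fun t ht ↦
    not_le.1 (Nat.findGreatest_is_greatest (P := fun i ↦ A i ≤ t * L) (Nat.lt_succ_self _) ht)
  refine ⟨fun t ↦ y (idx t), fun t ↦ ∑ i ∈ Finset.range N,
    (Ico (A i / L) (A (i + 1) / L)).indicator (fun _ ↦ m i) t, ?_, ?_, ?_, ?_, ?_, ?_⟩
  · exact Finset.measurable_sum _ fun i _ ↦ measurable_const.indicator measurableSet_Ico
  · have h := hidx_le 0 le_rfl
    rw [zero_mul] at h
    nth_rw 2 [← hA0] at h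
    rw [hAmono.le_iff_le, Nat.le_zero] at h
    simp only [h]
  · have h : idx 1 = N := le_antisymm (hidxN 1)
      (Nat.le_findGreatest le_rfl (by rw [one_mul]))
    simp only [h]
  · intro s hs t ht
    wlog hst : s ≤ t generalizing s t
    · rw [dist_comm, abs_sub_comm]
      exact this t ht s hs (le_of_not_ge hst)
    have hij : idx s ≤ idx t := Nat.findGreatest_mono_left
      (fun i hi ↦ hi.trans (mul_le_mul_of_nonneg_right hst hLpos.le)) N
    have hdist : dist (y (idx s)) (y (idx t)) ≤ A (idx t) - A (idx s) := by
      rw [← Finset.sum_Ico_eq_sub _ hij]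
      exact dist_le_Ico_sum_of_dist_le hij fun _ hk ↦ hd _ (hk.trans_le (hidxN t))
    change dist (y (idx s)) (y (idx t)) ≤ _
    rw [abs_sub_comm, abs_of_nonneg (sub_nonneg.2 hst), mul_sub, mul_comm L, mul_comm L]
    rcases (hidxN s).lt_or_eq with hlt | heq
    · linarith [hidx_le t ht.1, hidx_lt s hlt, hAs (idx s), haη (idx s)]
    · have h' : A (idx t) ≤ A (idx s) := heq ▸ hAmono.monotone (hidxN t)
      have : s * L ≤ t * L := mul_le_mul_of_nonneg_right hst hLpos.le
      linarith [ha 0, haη 0]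
  · intro t ht
    have hlt : idx t < N := by
      refine (hidxN t).lt_of_ne fun h ↦ ?_
      have h1 := hidx_le t ht.1
      rw [h] at h1
      have := mul_lt_mul_of_pos_right ht.2 hLpos
      linarith
    refine ⟨idx t, hlt, rfl, ?_⟩
    have hmem : t ∈ Ico (A (idx t) / L) (A (idx t + 1) / L) :=
      ⟨(div_le_iff₀ hLpos).2 (hidx_le t ht.1), (lt_div_iff₀ hLpos).2 (hidx_lt t hlt)⟩
    have h := Finset.single_le_sum
      (f := fun i ↦ (Ico (A i / L) (A (i + 1) / L)).indicator (fun _ ↦ m i) t)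
      (fun _ _ ↦ zero_le) (Finset.mem_range.2 hlt)
    simpa only [indicator_of_mem hmem] using h
  · rw [lintegral_finsetSum _ fun i _ ↦ measurable_const.indicator measurableSet_Ico,
      Finset.mul_sum]
    refine Finset.sum_congr rfl fun i _ ↦ ?_
    rw [lintegral_indicator_const measurableSet_Ico, Real.volume_Ico, ← sub_div, hAs,
      add_sub_cancel_left, mul_left_comm, ← ENNReal.ofReal_mul hLpos.le,
      mul_div_cancel₀ _ hLpos.ne', mul_comm]

/-- A version of the Arzelà–Ascoli theorem: maps `f n : [0, 1] → X` which are `l n`-Lipschitz up to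
errors `η n` tending to `0` subconverge pointwise to a Lipschitz map. -/
theorem exists_tendsto_lipschitzOnWith [CompactSpace X] {f : ℕ → ℝ → X} {l η : ℕ → ℝ} {M : ℝ}
    (hl0 : ∀ n, 0 ≤ l n) (hlM : ∀ n, l n ≤ M) (hη : Tendsto η atTop (𝓝 0))
    (hf : ∀ n, ∀ s ∈ Icc (0 : ℝ) 1, ∀ t ∈ Icc (0 : ℝ) 1,
      dist (f n s) (f n t) ≤ l n * |s - t| + η n) :
    ∃ φ : ℕ → ℕ, StrictMono φ ∧ ∃ (F : ℝ → X) (l' : ℝ≥0),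
      Tendsto (fun n ↦ l (φ n)) atTop (𝓝 l') ∧
      (∀ t ∈ Icc (0 : ℝ) 1, Tendsto (fun n ↦ f (φ n) t) atTop (𝓝 (F t))) ∧
      LipschitzOnWith l' F (Icc 0 1) := by
  set d : ℕ → unitInterval := TopologicalSpace.denseSeq unitInterval with hd
  obtain ⟨⟨l', G⟩, hmem, φ, hφ, hlim⟩ := (isCompact_Icc.prod isCompact_univ).tendsto_subseq
    (x := fun n ↦ ((l n, fun k ↦ f n (d k)) : ℝ × (ℕ → X)))
    (fun n ↦ ⟨⟨hl0 n, hlM n⟩, mem_univ _⟩ : ∀ n, _ ∈ Icc (0 : ℝ) M ×ˢ (univ : Set (ℕ → X)))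
  obtain ⟨hliml, hlimG⟩ := (Prod.tendsto_iff _ _).1 hlim
  rw [tendsto_pi_nhds] at hlimG
  have hηφ : Tendsto (fun n ↦ η (φ n)) atTop (𝓝 0) := hη.comp hφ.tendsto_atTop
  have hM : 0 ≤ M := (hl0 0).trans (hlM 0)
  have hcauchy : ∀ t ∈ Icc (0 : ℝ) 1, ∃ z, Tendsto (fun n ↦ f (φ n) t) atTop (𝓝 z) := by
    intro t ht
    refine cauchySeq_tendsto_of_complete (Metric.cauchySeq_iff.2 fun ε hε ↦ ?_)
    obtain ⟨k, hk⟩ := (TopologicalSpace.denseRange_denseSeq unitInterval).exists_dist_lt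
      (⟨t, ht⟩ : unitInterval) (show 0 < ε / (8 * (M + 1)) by positivity)
    have hk' : M * |t - d k| ≤ ε / 8 := by
      have h1 : |t - d k| < ε / (8 * (M + 1)) := by
        rwa [Subtype.dist_eq, Real.dist_eq] at hk
      rw [lt_div_iff₀ (by positivity)] at h1
      nlinarith [abs_nonneg (t - d k)]
    have hnear : ∀ n, η (φ n) < ε / 8 → dist (f (φ n) t) (f (φ n) (d k)) ≤ ε / 4 := fun n hn ↦ by
      have h1 := hf (φ n) t ht _ (d k).2
      have h2 := mul_le_mul_of_nonneg_right (hlM (φ n)) (abs_nonneg (t - d k))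
      linarith
    obtain ⟨N₁, hN₁⟩ := Metric.cauchySeq_iff.1 (hlimG k).cauchySeq (ε / 4) (by positivity)
    obtain ⟨N₂, hN₂⟩ := eventually_atTop.1
      (hηφ.eventually (gt_mem_nhds (show (0 : ℝ) < ε / 8 by positivity)))
    refine ⟨max N₁ N₂, fun p hp q hq ↦ ?_⟩
    have h1 := hnear p (hN₂ p (le_of_max_le_right hp))
    have h2 := hnear q (hN₂ q (le_of_max_le_right hq))
    rw [dist_comm] at h2
    have h3 : dist (f (φ p) (d k)) (f (φ q) (d k)) < ε / 4 :=
      hN₁ p (le_of_max_le_left hp) q (le_of_max_le_left hq)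
    linarith [dist_triangle4 (f (φ p) t) (f (φ p) (d k)) (f (φ q) (d k)) (f (φ q) t)]
  have : Nonempty X := ⟨f 0 0⟩
  choose! F hF using hcauchy
  refine ⟨φ, hφ, F, ⟨l', hmem.1.1⟩, hliml, hF, ?_⟩
  refine LipschitzOnWith.of_dist_le_mul fun s hs t ht ↦ ?_
  have h := (Tendsto.mul_const |s - t| hliml).add hηφ
  rw [add_zero] at h
  exact le_of_tendsto_of_tendsto' ((hF s hs).dist (hF t ht)) h fun n ↦ hf (φ n) s hs t ht

/-- Chains of bounded length, with steps tending to `0`, along which the discrete integrals of a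
lower semicontinuous function `ρ` are at most `B`, subconverge to a rectifiable curve along which
`ρ` has integral at most `B`. -/
theorem exists_curve_of_chains [CompactSpace X] [MeasurableSpace X] [BorelSpace X]
    {ρ : X → ℝ≥0∞} (hρ : LowerSemicontinuous ρ) {y : ℕ → ℕ → X} {a : ℕ → ℕ → ℝ}
    {m : ℕ → ℕ → ℝ≥0∞} {N : ℕ → ℕ} {η : ℕ → ℝ} {M : ℝ} {B : ℝ≥0∞}
    (hη : Tendsto η atTop (𝓝 0)) (hN : ∀ n, 0 < N n) (ha : ∀ n i, 0 < a n i)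
    (haη : ∀ n i, a n i ≤ η n) (hd : ∀ n, ∀ i < N n, dist (y n i) (y n (i + 1)) ≤ a n i)
    (hM : ∀ n, ∑ i ∈ Finset.range (N n), a n i ≤ M)
    (hm : ∀ n, ∀ i < N n, ⨅ z ∈ Metric.closedBall (y n i) (η n), ρ z ≤ m n i)
    (hB : ∀ n, ∑ i ∈ Finset.range (N n), ENNReal.ofReal (a n i) * m n i ≤ B) :
    ∃ γ : Curve X, Rectifiable γ ∧ lineIntegral ρ γ ≤ B ∧ ∃ φ : ℕ → ℕ, StrictMono φ ∧
      Tendsto (fun n ↦ y (φ n) 0) atTop (𝓝 (γ 0)) ∧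
      Tendsto (fun n ↦ y (φ n) (N (φ n))) atTop (𝓝 (γ 1)) := by
  choose f g hgm hf0 hf1 hflip hfg hint using fun n ↦
    exists_step_parametrization (m := m n) (hN n) (ha n) (haη n) (hd n)
  obtain ⟨φ, hφ, F, l, hl, hF, hFlip⟩ := exists_tendsto_lipschitzOnWith
    (fun n ↦ Finset.sum_nonneg fun i _ ↦ (ha n i).le) hM hη hflip
  set γ : Curve X := ⟨fun t ↦ F t, hFlip.continuousOn.comp_continuous continuous_subtype_val
    fun t ↦ t.2⟩
  have hγ : ∀ t : unitInterval, γ t = F t := fun _ ↦ rfl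
  refine ⟨γ, rectifiable_of_lipschitzOnWith hFlip hγ, ?_, φ, hφ, ?_, ?_⟩
  · refine (lineIntegral_le_of_lipschitzOnWith hFlip hγ hρ.measurable).trans ?_
    have hηφ : Tendsto (fun n ↦ η (φ n)) atTop (𝓝 0) := hη.comp hφ.tendsto_atTop
    have hl' : Tendsto (fun n ↦ ENNReal.ofReal (∑ i ∈ Finset.range (N (φ n)), a (φ n) i)) atTop
        (𝓝 (l : ℝ≥0∞)) := by
      simpa using ENNReal.tendsto_ofReal hl
    have hpt : ∀ t ∈ Ico (0 : ℝ) 1, l * ρ (F t) ≤ liminf (fun n ↦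
        ENNReal.ofReal (∑ i ∈ Finset.range (N (φ n)), a (φ n) i) * g (φ n) t) atTop := by
      intro t ht
      refine ENNReal.mul_le_of_forall_lt fun b hb c hc ↦ ?_
      obtain ⟨ε, hε, hball⟩ := Metric.eventually_nhds_iff_ball.1 (hρ (F t) c hc)
      refine le_liminf_of_le (by isBoundedDefault) ?_
      filter_upwards [hl'.eventually (lt_mem_nhds hb),
        hηφ.eventually (gt_mem_nhds (half_pos hε)),
        (hF t (Ico_subset_Icc_self ht)).eventually (Metric.ball_mem_nhds _ (half_pos hε))]
        with n hn1 hn2 hn3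
      obtain ⟨i, hi, hfi, hmi⟩ := hfg (φ n) t ht
      gcongr
      refine le_trans (le_iInf₂ fun z hz ↦ (hball z ?_).le) ((hm (φ n) i hi).trans hmi)
      rw [← hfi, Metric.mem_closedBall] at hz
      rw [Metric.mem_ball]
      linarith [dist_triangle z (f (φ n) t) (F t)]
    calc l * ∫⁻ t in Icc (0 : ℝ) 1, ρ (F t)
        = ∫⁻ t in Ico (0 : ℝ) 1, l * ρ (F t) := by
          rw [← setLIntegral_congr Ico_ae_eq_Icc, lintegral_const_mul' _ _ ENNReal.coe_ne_top]
      _ ≤ ∫⁻ t in Ico (0 : ℝ) 1, liminf (fun n ↦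
            ENNReal.ofReal (∑ i ∈ Finset.range (N (φ n)), a (φ n) i) * g (φ n) t) atTop :=
          setLIntegral_mono' measurableSet_Ico hpt
      _ ≤ liminf (fun n ↦ ∫⁻ t in Ico (0 : ℝ) 1,
            ENNReal.ofReal (∑ i ∈ Finset.range (N (φ n)), a (φ n) i) * g (φ n) t) atTop :=
          lintegral_liminf_le fun n ↦ (hgm _).const_mul _
      _ ≤ liminf (fun _ : ℕ ↦ B) atTop := by
          refine liminf_le_liminf (Eventually.of_forall fun n ↦ ?_)
          rw [lintegral_const_mul _ (hgm _)]
          exact (mul_le_mul_right (setLIntegral_le_lintegral _ _) _).trans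
            ((hint (φ n)).trans_le (hB (φ n)))
      _ = B := liminf_const B
  · simpa only [hf0] using! hF 0 (by simp)
  · simpa only [hf1] using! hF 1 (by simp)

end Chains

/-! ### Chains of pieces along a connected set -/

section PieceChains

variable {X : Type*} [MetricSpace X]

/-- Two points of a connected set covered by finitely many pieces are joined by a chain of distinct
pieces. The pieces need not be closed, so that consecutive pieces of the chain only have
intersecting closures. -/
theorem exists_chain_of_isPreconnected {ι : Type*} [Finite ι] {B : ι → Set X} {E : Set X}
    (hE : IsPreconnected E) (hcov : E ⊆ ⋃ i, B i) {a b : X} (ha : a ∈ E) (hb : b ∈ E) :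
    ∃ (n : ℕ) (p : ℕ → ι) (y : ℕ → X), InjOn p (Iio (n + 1)) ∧ y 0 = a ∧ y (n + 1) = b ∧
      ∀ i < n + 1, y i ∈ closure (B (p i)) ∧ y (i + 1) ∈ closure (B (p i)) := by
  classical
  obtain ⟨i, hi⟩ := mem_iUnion.1 (hcov ha)
  obtain ⟨j, hj⟩ := mem_iUnion.1 (hcov hb)
  let G : SimpleGraph ι :=
    { Adj := fun s t ↦ s ≠ t ∧ (closure (B s) ∩ closure (B t)).Nonempty
      symm := ⟨fun _ _ h ↦ ⟨h.1.symm, by rw [inter_comm]; exact h.2⟩⟩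
      loopless := ⟨fun _ h ↦ h.1 rfl⟩ }
  -- otherwise the closures of the reachable pieces and those of the others disconnect the set
  have hreach : G.Reachable i j := by
    by_contra hij
    have hclosed : ∀ T : Set ι, IsClosed (⋃ s ∈ T, closure (B s)) := fun T ↦
      T.toFinite.isClosed_biUnion fun _ _ ↦ isClosed_closure
    obtain ⟨z, -, hz, hz'⟩ := isPreconnected_closed_iff.1 hE
      (⋃ s ∈ {s | G.Reachable i s}, closure (B s)) (⋃ s ∈ {s | ¬ G.Reachable i s}, closure (B s))
      (hclosed _) (hclosed _) (fun z hz ↦ by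
        obtain ⟨s, hs⟩ := mem_iUnion.1 (hcov hz)
        by_cases h : G.Reachable i s
        · exact Or.inl (mem_biUnion (x := s) h (subset_closure hs))
        · exact Or.inr (mem_biUnion (x := s) h (subset_closure hs)))
      ⟨a, ha, mem_biUnion (x := i) (SimpleGraph.Reachable.refl i) (subset_closure hi)⟩
      ⟨b, hb, mem_biUnion (x := j) hij (subset_closure hj)⟩
    obtain ⟨s, hs, hzs⟩ := mem_iUnion₂.1 hz
    obtain ⟨t, ht, hzt⟩ := mem_iUnion₂.1 hz'
    have hst : s ≠ t := fun h ↦ ht (h ▸ hs)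
    have hadj : G.Adj s t := ⟨hst, z, hzs, hzt⟩
    exact ht (SimpleGraph.Reachable.trans hs hadj.reachable)
  obtain ⟨w, hw⟩ := hreach.exists_isPath
  have hstep : ∀ k < w.length,
      (closure (B (w.getVert k)) ∩ closure (B (w.getVert (k + 1)))).Nonempty := fun k hk ↦
    (w.adj_getVert_succ hk).2
  have : Nonempty X := ⟨a⟩
  choose! z hz using hstep
  refine ⟨w.length, w.getVert,
    fun k ↦ if k = 0 then a else if k - 1 < w.length then z (k - 1) else b,
    ?_, by simp, by simp, ?_⟩
  · exact hw.getVert_injOn.mono fun k hk ↦ Nat.lt_succ_iff.1 hk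
  · intro k hk
    constructor
    · rcases k with _ | k
      · simpa using subset_closure hi
      · have hk' : k < w.length := by omega
        simpa [hk'] using (hz k hk').2
    · by_cases hk' : k < w.length
      · simpa [hk'] using (hz k hk').1
      · have hkl : k = w.length := by omega
        subst hkl
        simpa using subset_closure hj

end PieceChains

/-! ### Quasi-packings by small pieces -/

section Packing

variable {X : Type*} [MetricSpace X]

/-- A finite cover `S` by pieces which are round, up to the factor `K`, around the inner balls of
centres `x s` and radii `r s ≤ ε`, at most `⌊K⌋ + 1` of which have a common point. -/
structure IsRoundCover (K ε : ℝ) (S : Set (Set X)) (x : S → X) (r : S → ℝ) : Prop where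
  finite : Finite S
  cover : ⋃₀ S = univ
  pos : ∀ s, 0 < r s
  le : ∀ s, r s ≤ ε
  closedBall_subset : ∀ s : S, Metric.closedBall (x s) (r s) ⊆ s
  subset_closedBall : ∀ s : S, (s : Set X) ⊆ Metric.closedBall (x s) (K * r s)
  overlap : ∀ y, {s : S | y ∈ Metric.closedBall (x s) (r s)}.ncard ≤ ⌊K⌋₊ + 1

/-- The inner balls through a point all meet any one of them, so that their number is at most one
more than the number of inner balls that meet a given one. -/
theorem ncard_closedBall_le {S : Set (Set X)} [Finite S] {x : S → X} {r : S → ℝ} {K : ℝ}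
    (h : ∀ s : S, ({s' : S | s' ≠ s ∧ (Metric.closedBall (x s) (r s) ∩
        Metric.closedBall (x s') (r s')).Nonempty}.ncard : ℝ) ≤ K) (y : X) :
    {s : S | y ∈ Metric.closedBall (x s) (r s)}.ncard ≤ ⌊K⌋₊ + 1 := by
  rcases eq_empty_or_nonempty {s : S | y ∈ Metric.closedBall (x s) (r s)} with h0 | ⟨s, hs⟩
  · rw [h0, ncard_empty]; exact zero_le
  · have hsub : {s : S | y ∈ Metric.closedBall (x s) (r s)} ⊆ insert s {s' : S | s' ≠ s ∧
        (Metric.closedBall (x s) (r s) ∩ Metric.closedBall (x s') (r s')).Nonempty} := by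
      intro s' hs'
      by_cases hss : s' = s
      · exact Or.inl hss
      · exact Or.inr ⟨hss, y, hs, hs'⟩
    refine (ncard_le_ncard hsub (toFinite _)).trans ((ncard_insert_le _ _).trans ?_)
    exact Nat.add_le_add_right (Nat.le_floor (h s)) 1

variable [MeasurableSpace X] {μ : Measure X} {Q A K : ℝ}

theorem AhlforsRegular.isFiniteMeasure [CompactSpace X] [Nonempty X] (hμ : AhlforsRegular μ Q A)
    (hX : 0 < Metric.diam (univ : Set X)) : IsFiniteMeasure μ := by
  obtain ⟨x⟩ := ‹Nonempty X›
  have h : Metric.closedBall x (Metric.diam (univ : Set X)) = univ := eq_univ_of_forall fun y ↦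
    Metric.dist_le_diam_of_mem isCompact_univ.isBounded (mem_univ _) (mem_univ _)
  exact ⟨h ▸ (hμ x _ hX le_rfl).2.trans_lt ENNReal.ofReal_lt_top⟩

theorem AhlforsRegular.measure_closedBall_ne_zero (hμ : AhlforsRegular μ Q A) (hA : 1 ≤ A) {x : X}
    {R : ℝ} (hR : 0 < R) (hR' : R ≤ Metric.diam (univ : Set X)) :
    μ (Metric.closedBall x R) ≠ 0 := by
  have : 0 < A⁻¹ * R ^ Q := by positivity
  exact ((ENNReal.ofReal_pos.2 this).trans_le (hμ x R hR hR').1).ne'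

theorem AhlforsRegular.measure_closedBall_mul_le (hμ : AhlforsRegular μ Q A) (hA : 1 ≤ A) {x : X}
    {R Λ : ℝ} (hΛ : 1 ≤ Λ) (hR : 0 < R) (hR' : Λ * R ≤ Metric.diam (univ : Set X)) :
    μ (Metric.closedBall x (Λ * R)) ≤
      (A ^ 2 * Λ ^ Q).toNNReal * μ (Metric.closedBall x R) := by
  have hRR : R ≤ Λ * R := le_mul_of_one_le_left hR.le hΛ
  have hΛ0 : 0 < Λ := one_pos.trans_le hΛ
  have hA0 : 0 < A := one_pos.trans_le hA
  calc μ (Metric.closedBall x (Λ * R)) ≤ ENNReal.ofReal (A * (Λ * R) ^ Q) :=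
        (hμ x _ (by positivity) hR').2
    _ = ENNReal.ofReal (A ^ 2 * Λ ^ Q) * ENNReal.ofReal (A⁻¹ * R ^ Q) := by
        rw [← ENNReal.ofReal_mul (by positivity), Real.mul_rpow hΛ0.le hR.le]
        congr 1
        field_simp
    _ ≤ _ := mul_le_mul_right (hμ x R hR (hRR.trans hR')).1 _

/-- The radius of a ball is controlled by the diameter of any set that contains it. This rests on
Ahlfors regularity: in a general metric space, a ball may have a much smaller diameter than its
radius. -/
theorem AhlforsRegular.radius_le (hμ : AhlforsRegular μ Q A) (hQ : 0 < Q) (hA : 1 ≤ A)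
    [CompactSpace X] {x : X} {R δ : ℝ} {s : Set X} (hR : 0 < R)
    (hs : Metric.closedBall x R ⊆ s) (hδ : 0 < δ) (hsδ : Metric.ediam s ≤ ENNReal.ofReal δ)
    (hδX : δ < Metric.diam (univ : Set X)) : R ≤ (A ^ 2) ^ (1 / Q) * δ := by
  have hA0 : 0 < A := one_pos.trans_le hA
  have hdist : ∀ y ∈ s, ∀ z ∈ s, dist y z ≤ δ := fun y hy z hz ↦
    (edist_le_ofReal hδ.le).1 ((Metric.edist_le_ediam_of_mem hy hz).trans hsδ)
  have hRX : R ≤ Metric.diam (univ : Set X) := by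
    by_contra! h
    have hball : ∀ y, y ∈ s := fun y ↦ hs <| (Metric.dist_le_diam_of_mem
      isCompact_univ.isBounded (mem_univ _) (mem_univ _)).trans h.le
    exact hδX.not_ge (Metric.diam_le_of_forall_dist_le hδ.le fun y _ z _ ↦
      hdist y (hball y) z (hball z))
  have hsub : Metric.closedBall x R ⊆ Metric.closedBall x δ := fun y hy ↦
    hdist y (hs hy) x (hs (Metric.mem_closedBall_self hR.le))
  have h := ((hμ x R hR hRX).1.trans (measure_mono hsub)).trans (hμ x δ hδ hδX.le).2
  rw [ENNReal.ofReal_le_ofReal_iff (by positivity), inv_mul_le_iff₀ hA0] at h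
  have h' : R ^ Q ≤ ((A ^ 2) ^ (1 / Q) * δ) ^ Q := by
    rw [Real.mul_rpow (by positivity) hδ.le, ← Real.rpow_mul (by positivity),
      one_div_mul_cancel hQ.ne', Real.rpow_one]
    linarith
  exact (Real.rpow_le_rpow_iff hR.le (by positivity) hQ).1 h'

/-- When the mesh tends to `0`, the radii of the inner balls tend to `0` uniformly. -/
theorem eventually_exists_isRoundCover [CompactSpace X] (hμ : AhlforsRegular μ Q A) (hQ : 0 < Q)
    (hA : 1 ≤ A) (hX : 0 < Metric.diam (univ : Set X)) {S : ℕ → Set (Set X)}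
    (hS : ∀ n, IsQuasiPacking K (S n)) (hmesh : Tendsto (fun n ↦ mesh (S n)) atTop (𝓝 0))
    {ε : ℝ} (hε : 0 < ε) :
    ∀ᶠ n in atTop, ∃ x r, IsRoundCover K ε (S n) x r := by
  set c := (A ^ 2) ^ (1 / Q) with hc
  have hc0 : 0 < c := by positivity
  set δ := min (ε / c) (Metric.diam (univ : Set X) / 2) with hδ
  have hδ0 : 0 < δ := lt_min (by positivity) (by positivity)
  have hδX : δ < Metric.diam (univ : Set X) := (min_le_right _ _).trans_lt (half_lt_self hX)
  filter_upwards [hmesh.eventually (ge_mem_nhds (ENNReal.ofReal_pos.2 hδ0))] with n hn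
  obtain ⟨x, r, hx, hr, hball, hover⟩ := (hS n).exists_balls
  have hfin : Finite (S n) := by
    exact finite_univ_iff.1 ((hS n).locallyFinite.finite_nonempty_of_compact.subset
      fun s _ ↦ ⟨x s, hx s⟩)
  refine ⟨x, r, hfin, (hS n).cover, hr, fun s ↦ ?_, fun s ↦ (hball s).1, fun s ↦ (hball s).2,
    ncard_closedBall_le fun s ↦ (hover s).2⟩
  have h := hμ.radius_le hQ hA (hr s) (hball s).1 hδ0
    ((le_biSup Metric.ediam s.2).trans hn) hδX
  calc r s ≤ c * δ := h
    _ ≤ c * (ε / c) := by gcongr; exact min_le_left _ _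
    _ = ε := mul_div_cancel₀ _ hc0.ne'

end Packing

/-! ### The analytic modulus is bounded by the combinatorial modulus -/

section AnalyticLeCombinatorial

variable {X : Type*} [MetricSpace X]

theorem graphInfLength_curveTrace_image {S : Set (Set X)} (ρ : S → ℝ≥0) (Γ : Set (Curve X)) :
    graphInfLength (G := nerve S) ρ (curveTrace S '' Γ) =
      ⨅ γ ∈ Γ, graphLength ρ (piecesMeeting S (range γ)) := by
  simp only [graphInfLength, iInf_image]
  rfl

theorem graphLength_eq_sum {V : Type*} [Fintype V] (ρ : V → ℝ≥0) (T : Set V) :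
    graphLength ρ T = ∑ s, T.indicator (fun s ↦ (ρ s : ℝ≥0∞)) s := by
  rw [graphLength, tsum_subtype T fun s ↦ (ρ s : ℝ≥0∞), tsum_fintype]

variable [MeasurableSpace X] {μ : Measure X} {Q A K : ℝ}

/-- The constant in `modulus_le_mul_combModulus`. -/
noncomputable def analyticConst (Q A K : ℝ) : ℝ≥0 :=
  enlargeConst Q (A ^ 2 * (10 * K) ^ Q).toNNReal ^ Q *
    (((⌊K⌋₊ + 1 : ℕ) : ℝ≥0) ^ (Q - 1) * A.toNNReal) + 1

/-- The function on `X` associated with a weight `ρ` on the pieces of the cover is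
`∑ ρ(s) / (L K r_s) 1_{B(x_s, 2 K r_s)}`, `L` being the combinatorial length of the family. A curve
that meets `s` has length at least `K r_s` in `B(x_s, 2 K r_s)`, hence admissibility. -/
theorem modulus_le_mul_combModulus [BorelSpace X] [CompactSpace X] [Nonempty X]
    (hμ : AhlforsRegular μ Q A) (hQ : 1 < Q) (hA : 1 ≤ A) (hK : 1 ≤ K)
    (hX : 0 < Metric.diam (univ : Set X)) {ε : ℝ}
    (hεX : 10 * K * ε ≤ Metric.diam (univ : Set X)) {S : Set (Set X)} {x : S → X} {r : S → ℝ}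
    (hS : IsRoundCover K ε S x r) {Γ : Set (Curve X)}
    (hΓ : ∀ γ ∈ Γ, ∃ u v : unitInterval, 4 * K * ε < dist (γ u) (γ v)) :
    modulus μ Q Γ ≤ analyticConst Q A K * combModulus Q S Γ := by
  have hQ0 : 0 < Q := one_pos.trans hQ
  have hK0 : 0 < K := one_pos.trans_le hK
  have := hS.finite
  have : IsFiniteMeasure μ := hμ.isFiniteMeasure hX
  let _ : Fintype S := Fintype.ofFinite S
  set C := analyticConst Q A K with hC
  have hC0 : (C : ℝ≥0∞) ≠ 0 := by
    rw [hC, analyticConst, ENNReal.coe_add, ENNReal.coe_one]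
    exact (zero_lt_one.trans_le le_add_self).ne'
  rw [mul_comm, ← ENNReal.div_le_iff_le_mul (Or.inl hC0) (Or.inl ENNReal.coe_ne_top)]
  refine le_iInf₂ fun ρ hρ ↦ ?_
  rw [ENNReal.div_le_iff_le_mul (Or.inl hC0) (Or.inl ENNReal.coe_ne_top),
    graphInfLength_curveTrace_image]
  set L := ⨅ γ ∈ Γ, graphLength ρ (piecesMeeting S (range γ)) with hL
  rcases eq_or_ne L 0 with hL0 | hL0
  · rw [hL0, ENNReal.zero_rpow_of_pos hQ0, ENNReal.div_zero hρ.1.ne', ENNReal.top_mul hC0]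
    exact le_top
  have hlen : ∀ γ ∈ Γ, L ≤ graphLength ρ (piecesMeeting S (range γ)) := fun γ hγ ↦ iInf₂_le γ hγ
  rcases eq_or_ne L ∞ with hLt | hLt
  · -- an infinite combinatorial length means that the family is empty
    have hempty : ∀ γ, γ ∉ Γ := fun γ hγ ↦ by
      have h := hlen γ hγ
      rw [hLt, top_le_iff, graphLength_eq_sum] at h
      refine (ENNReal.sum_ne_top.2 fun s _ ↦ ?_) h
      exact ne_top_of_le_ne_top ENNReal.coe_ne_top (indicator_le_self' (fun _ _ ↦ zero_le) s)
    have h0 : modulus μ Q Γ ≤ ∫⁻ _, (0 : ℝ≥0∞) ^ Q ∂μ :=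
      iInf₂_le (fun _ ↦ 0) ⟨measurable_const, fun γ hγ ↦ absurd hγ (hempty γ)⟩
    simp only [ENNReal.zero_rpow_of_pos hQ0, lintegral_zero] at h0
    exact h0.trans zero_le
  lift L to ℝ≥0 using hLt with l
  have hl0 : 0 < l := pos_iff_ne_zero.2 fun h ↦ hL0 (by rw [h, ENNReal.coe_zero])
  set R : S → ℝ≥0 := fun s ↦ (K * r s).toNNReal with hR
  have hRpos : ∀ s, 0 < R s := fun s ↦ Real.toNNReal_pos.2 (mul_pos hK0 (hS.pos s))
  have hRc : ∀ s, (R s : ℝ) = K * r s := fun s ↦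
    Real.coe_toNNReal _ (mul_pos hK0 (hS.pos s)).le
  set a : S → ℝ≥0 := fun s ↦ ρ s / (l * R s) with ha
  set f : X → ℝ≥0∞ := fun y ↦
    ∑ s, (Metric.closedBall (x s) (2 * K * r s)).indicator (fun _ ↦ (a s : ℝ≥0∞)) y with hf
  have hfm : Measurable f := Finset.measurable_sum _ fun s _ ↦
    measurable_const.indicator Metric.isClosed_closedBall.measurableSet
  have hadm : Admissible Γ f := by
    refine ⟨hfm, fun γ hγ hrect ↦ ?_⟩
    have hmeas : ∀ s, MeasurableSet
        (arcLengthParamExtend γ ⁻¹' Metric.closedBall (x s) (2 * K * r s)) := fun s ↦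
      hrect.continuous_arcLengthParamExtend.measurable Metric.isClosed_closedBall.measurableSet
    have hint : lineIntegral f γ = ∑ s, a s * volume (Icc 0 (curveLength γ).toReal ∩
        arcLengthParamExtend γ ⁻¹' Metric.closedBall (x s) (2 * K * r s)) := by
      rw [lineIntegral_eq_extend]
      have hcomp : ∀ t, f (arcLengthParamExtend γ t) = ∑ s,
          (arcLengthParamExtend γ ⁻¹' Metric.closedBall (x s) (2 * K * r s)).indicator
            (fun _ ↦ (a s : ℝ≥0∞)) t := fun t ↦ rfl
      simp only [hcomp]
      rw [lintegral_finsetSum _ fun s _ ↦ measurable_const.indicator (hmeas s)]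
      refine Finset.sum_congr rfl fun s _ ↦ ?_
      rw [lintegral_indicator_const (hmeas s), Measure.restrict_apply (hmeas s), inter_comm]
    have hterm : ∀ s, (piecesMeeting S (range γ)).indicator (fun s ↦ (ρ s : ℝ≥0∞)) s ≤
        l * (a s * volume (Icc 0 (curveLength γ).toReal ∩
          arcLengthParamExtend γ ⁻¹' Metric.closedBall (x s) (2 * K * r s))) := by
      intro s
      by_cases hs : s ∈ piecesMeeting S (range γ)
      · rw [indicator_of_mem hs]
        obtain ⟨_, hzs, b, rfl⟩ := hs
        have hb : dist (γ b) (x s) ≤ K * r s := hS.subset_closedBall s hzs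
        obtain ⟨b', hb'⟩ : ∃ b', 2 * (K * r s) < dist (γ b') (x s) := by
          by_contra! hcon
          obtain ⟨u, v, huv⟩ := hΓ γ hγ
          have h1 : K * r s ≤ K * ε := mul_le_mul_of_nonneg_left (hS.le s) hK0.le
          linarith [hcon u, hcon v, dist_triangle_right (γ u) (γ v) (x s)]
        have hvol := hrect.ofReal_le_volume_preimage_closedBall hb hb'
        rw [← mul_assoc 2 K] at hvol
        calc (ρ s : ℝ≥0∞) = l * (a s * R s) := by
              rw [← ENNReal.coe_mul, ← ENNReal.coe_mul, ha]
              congr 1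
              have := (hRpos s).ne'
              field_simp
          _ ≤ _ := by gcongr; exact hvol
      · rw [indicator_of_notMem hs]
        exact zero_le
    have h1 : (l : ℝ≥0∞) ≤ l * lineIntegral f γ := by
      refine (hlen γ hγ).trans ?_
      rw [hint, graphLength_eq_sum, Finset.mul_sum]
      exact Finset.sum_le_sum fun s _ ↦ hterm s
    have hl0' : (l : ℝ≥0∞) ≠ 0 := ENNReal.coe_ne_zero.2 hl0.ne'
    rwa [← ENNReal.mul_le_mul_iff_right hl0' ENNReal.coe_ne_top, mul_one]
  have hsmall : ∀ s, 10 * K * r s ≤ Metric.diam (univ : Set X) := fun s ↦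
    (mul_le_mul_of_nonneg_left (hS.le s) (by positivity)).trans hεX
  have hsmall' : ∀ s, r s ≤ Metric.diam (univ : Set X) := fun s ↦
    (le_mul_of_one_le_left (hS.pos s).le (by linarith)).trans (hsmall s)
  have henl := lintegral_sum_indicator_closedBall_mul_rpow_le (μ := μ) (x := x) (r := r)
    (Λ := 2 * K) (c := (A ^ 2 * (10 * K) ^ Q).toNNReal) hQ (by linarith) hS.pos
    (fun s ↦ by
      rw [show 5 * (2 * K * r s) = 10 * K * r s by ring]
      exact hμ.measure_closedBall_mul_le hA (by linarith) (hS.pos s) (hsmall s))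
    (fun s ↦ hμ.measure_closedBall_ne_zero hA (hS.pos s) (hsmall' s)) a
  have hover := lintegral_sum_indicator_rpow_le (μ := μ)
    (B := fun s ↦ Metric.closedBall (x s) (r s))
    (fun s ↦ Metric.isClosed_closedBall.measurableSet) hQ.le hS.overlap a
  have hvol : ∀ s, (a s : ℝ≥0∞) ^ Q * μ (Metric.closedBall (x s) (r s)) ≤
      A.toNNReal * ((ρ s : ℝ≥0∞) ^ Q / (l : ℝ≥0∞) ^ Q) := by
    intro s
    have hr : μ (Metric.closedBall (x s) (r s)) ≤ A.toNNReal * (R s : ℝ≥0∞) ^ Q := by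
      refine (hμ _ _ (hS.pos s) (hsmall' s)).2.trans ?_
      rw [ENNReal.ofReal_mul (by linarith), ← ENNReal.ofReal_rpow_of_pos (hS.pos s)]
      refine mul_le_mul_right (ENNReal.rpow_le_rpow ?_ hQ0.le) _
      exact ENNReal.ofReal_le_ofReal (le_mul_of_one_le_left (hS.pos s).le hK)
    calc (a s : ℝ≥0∞) ^ Q * μ (Metric.closedBall (x s) (r s))
        ≤ (a s : ℝ≥0∞) ^ Q * (A.toNNReal * (R s : ℝ≥0∞) ^ Q) := mul_le_mul_right hr _
      _ = A.toNNReal * ((a s * R s : ℝ≥0) : ℝ≥0∞) ^ Q := by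
          rw [ENNReal.coe_mul, ENNReal.mul_rpow_of_nonneg _ _ hQ0.le, mul_left_comm]
      _ = _ := by
          rw [← ENNReal.div_rpow_of_nonneg _ _ hQ0.le, ← ENNReal.coe_div hl0.ne']
          congr 3
          rw [ha]
          have := (hRpos s).ne'
          field_simp
  calc modulus μ Q Γ ≤ ∫⁻ y, f y ^ Q ∂μ := iInf₂_le f hadm
    _ ≤ (enlargeConst Q (A ^ 2 * (10 * K) ^ Q).toNNReal : ℝ≥0∞) ^ Q *
          (((⌊K⌋₊ + 1 : ℕ) : ℝ≥0∞) ^ (Q - 1) *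
            ∑ s, A.toNNReal * ((ρ s : ℝ≥0∞) ^ Q / (l : ℝ≥0∞) ^ Q)) := by
        refine henl.trans (mul_le_mul_right (hover.trans (mul_le_mul_right ?_ _)) _)
        exact Finset.sum_le_sum fun s _ ↦ hvol s
    _ = graphVolume Q ρ / (l : ℝ≥0∞) ^ Q * ((enlargeConst Q (A ^ 2 * (10 * K) ^ Q).toNNReal) ^ Q *
          (((⌊K⌋₊ + 1 : ℕ) : ℝ≥0∞) ^ (Q - 1) * A.toNNReal)) := by
        rw [graphVolume, tsum_fintype, ← Finset.mul_sum]
        simp only [div_eq_mul_inv]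
        rw [← Finset.sum_mul]
        ring
    _ ≤ graphVolume Q ρ / (l : ℝ≥0∞) ^ Q * C := by
        refine mul_le_mul_right ?_ _
        rw [hC, analyticConst, ENNReal.coe_add, ENNReal.coe_mul, ENNReal.coe_mul,
          ENNReal.coe_rpow_of_nonneg _ hQ0.le, ENNReal.coe_rpow_of_nonneg _ (by linarith),
          ENNReal.coe_natCast]
        exact le_self_add

end AnalyticLeCombinatorial

/-! ### The combinatorial modulus is bounded by the analytic modulus -/

section CombinatorialLeAnalytic

variable {X : Type*} [MetricSpace X]

/-- The weight on the pieces of a cover associated with a function `ρ` on `X`: the diameter of the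
ball `B(x_s, K r_s)` times the infimum of `ρ` on `s`. -/
noncomputable def pieceWeight {S : Set (Set X)} (K : ℝ) (r : S → ℝ) (ρ : X → ℝ≥0∞) (s : S) : ℝ≥0 :=
  (ENNReal.ofReal (2 * K * r s) * ⨅ z ∈ (s : Set X), ρ z).toNNReal

variable [MeasurableSpace X] {μ : Measure X} {Q A K : ℝ}

/-- The constant in `graphVolume_pieceWeight_le`. -/
noncomputable def pieceConst (Q A K : ℝ) : ℝ≥0 :=
  (2 * K).toNNReal ^ Q * A.toNNReal * (⌊K⌋₊ + 1 : ℕ)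

theorem graphVolume_pieceWeight_le [BorelSpace X] (hμ : AhlforsRegular μ Q A) (hQ : 1 < Q)
    (hA : 1 ≤ A) (hK : 1 ≤ K) {ε : ℝ} (hεX : ε ≤ Metric.diam (univ : Set X)) {S : Set (Set X)}
    {x : S → X} {r : S → ℝ} (hS : IsRoundCover K ε S x r) {ρ : X → ℝ≥0∞} (hρ : Measurable ρ) :
    graphVolume Q (pieceWeight K r ρ) ≤ pieceConst Q A K * ∫⁻ y, ρ y ^ Q ∂μ := by
  have hQ0 : 0 < Q := one_pos.trans hQ
  have := hS.finite
  let _ : Fintype S := Fintype.ofFinite S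
  have hBm : ∀ s, MeasurableSet (Metric.closedBall (x s) (r s)) := fun s ↦
    Metric.isClosed_closedBall.measurableSet
  have hterm : ∀ s, (pieceWeight K r ρ s : ℝ≥0∞) ^ Q ≤
      ((2 * K).toNNReal : ℝ≥0∞) ^ Q * A.toNNReal *
        ∫⁻ y in Metric.closedBall (x s) (r s), ρ y ^ Q ∂μ := by
    intro s
    have hrs := hS.pos s
    have hr : ENNReal.ofReal (r s) ^ Q ≤ A.toNNReal * μ (Metric.closedBall (x s) (r s)) := by
      calc ENNReal.ofReal (r s) ^ Q = ENNReal.ofReal A * ENNReal.ofReal (A⁻¹ * r s ^ Q) := by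
            rw [ENNReal.ofReal_rpow_of_pos hrs, ← ENNReal.ofReal_mul (by linarith),
              mul_inv_cancel_left₀ (by linarith)]
        _ ≤ _ := mul_le_mul_right (hμ _ _ hrs ((hS.le s).trans hεX)).1 _
    calc (pieceWeight K r ρ s : ℝ≥0∞) ^ Q
        ≤ (ENNReal.ofReal (2 * K * r s) * ⨅ z ∈ (s : Set X), ρ z) ^ Q :=
          ENNReal.rpow_le_rpow ENNReal.coe_toNNReal_le_self hQ0.le
      _ = ((2 * K).toNNReal : ℝ≥0∞) ^ Q * ENNReal.ofReal (r s) ^ Q *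
            (⨅ z ∈ (s : Set X), ρ z) ^ Q := by
          rw [ENNReal.mul_rpow_of_nonneg _ _ hQ0.le, ENNReal.ofReal_mul (by linarith),
            ENNReal.mul_rpow_of_nonneg _ _ hQ0.le]
          rfl
      _ ≤ ((2 * K).toNNReal : ℝ≥0∞) ^ Q * (A.toNNReal * μ (Metric.closedBall (x s) (r s))) *
            (⨅ z ∈ (s : Set X), ρ z) ^ Q := by gcongr
      _ = ((2 * K).toNNReal : ℝ≥0∞) ^ Q * A.toNNReal *
            ∫⁻ _ in Metric.closedBall (x s) (r s), (⨅ z ∈ (s : Set X), ρ z) ^ Q ∂μ := by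
          rw [setLIntegral_const]
          ring
      _ ≤ _ := by
          refine mul_le_mul_right (setLIntegral_mono' (hBm s) fun y hy ↦ ?_) _
          exact ENNReal.rpow_le_rpow (iInf₂_le y (hS.closedBall_subset s hy)) hQ0.le
  have hsum : ∑ s, ∫⁻ y in Metric.closedBall (x s) (r s), ρ y ^ Q ∂μ ≤
      ((⌊K⌋₊ + 1 : ℕ) : ℝ≥0∞) * ∫⁻ y, ρ y ^ Q ∂μ := by
    classical
    simp only [← lintegral_indicator (hBm _)]
    rw [← lintegral_finsetSum _ fun s _ ↦ (hρ.pow_const Q).indicator (hBm s),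
      ← lintegral_const_mul _ (hρ.pow_const Q)]
    refine lintegral_mono fun y ↦ ?_
    simp only [indicator_apply]
    rw [← Finset.sum_filter, Finset.sum_const, nsmul_eq_mul]
    refine mul_le_mul_left (Nat.cast_le.2 ?_) _
    rw [← ncard_coe_finset]
    simpa using hS.overlap y
  rw [graphVolume, tsum_fintype]
  refine (Finset.sum_le_sum fun s _ ↦ hterm s).trans ?_
  rw [← Finset.mul_sum, pieceConst, ENNReal.coe_mul, ENNReal.coe_mul,
    ENNReal.coe_rpow_of_nonneg _ hQ0.le, mul_assoc (_ * _ : ℝ≥0∞), ENNReal.coe_natCast]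
  exact mul_le_mul_right hsum _

theorem coe_pieceWeight [BorelSpace X] (hμ : AhlforsRegular μ Q A) (hQ : 1 < Q)
    (hA : 1 ≤ A) {ε : ℝ} (hεX : ε ≤ Metric.diam (univ : Set X)) {S : Set (Set X)}
    {x : S → X} {r : S → ℝ} (hS : IsRoundCover K ε S x r) {ρ : X → ℝ≥0∞}
    (hρQ : ∫⁻ y, ρ y ^ Q ∂μ ≠ ∞) (s : S) :
    (pieceWeight K r ρ s : ℝ≥0∞) = ENNReal.ofReal (2 * K * r s) * ⨅ z ∈ (s : Set X), ρ z := by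
  refine ENNReal.coe_toNNReal (ENNReal.mul_ne_top ENNReal.ofReal_ne_top fun h ↦ hρQ ?_)
  have h' : ∀ z ∈ (s : Set X), ρ z = ∞ := by simpa [iInf_eq_top] using h
  have hB := hμ.measure_closedBall_ne_zero hA (x := x s) (hS.pos s) ((hS.le s).trans hεX)
  rw [← top_le_iff]
  calc ∞ = ∞ * μ (Metric.closedBall (x s) (r s)) := (ENNReal.top_mul hB).symm
    _ = ∞ * μ.restrict (Metric.closedBall (x s) (r s)) univ := by
        rw [Measure.restrict_apply_univ]
    _ = ∫⁻ _ in Metric.closedBall (x s) (r s), ∞ ∂μ := (lintegral_const _).symm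
    _ ≤ ∫⁻ y, ρ y ^ Q ∂μ := by
        refine (setLIntegral_mono' Metric.isClosed_closedBall.measurableSet fun y hy ↦ ?_).trans
          (setLIntegral_le_lintegral (Metric.closedBall (x s) (r s)) fun y ↦ ρ y ^ Q)
        rw [h' y (hS.closedBall_subset s hy), ENNReal.top_rpow_of_pos (one_pos.trans hQ)]

/-- A closed set `P` of pairs of points of `X` describes the end points of the family `Γ`: every
curve of `Γ` passes through both points of some pair in `P`, and every curve from the first to the
second point of a pair in `P` belongs to `Γ`. -/
structure IsEndpointSet (P : Set (X × X)) (Γ : Set (Curve X)) : Prop where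
  isClosed : IsClosed P
  exists_mem : ∀ γ ∈ Γ, ∃ u v : unitInterval, (γ u, γ v) ∈ P
  mem : ∀ γ : Curve X, (γ 0, γ 1) ∈ P → γ ∈ Γ

/-- For sufficiently fine covers, the weight associated with an admissible lower semicontinuous
function gives combinatorial length at least `1 / 2` to every curve of the family, rectifiable or
not. Otherwise, chains of pieces along curves of small combinatorial length would converge to a
rectifiable curve of the family with line integral less than `1`. -/
theorem exists_half_le_graphLength [BorelSpace X] [CompactSpace X] (hμ : AhlforsRegular μ Q A)
    (hQ : 1 < Q) (hA : 1 ≤ A) (hK : 1 ≤ K) (hX : 0 < Metric.diam (univ : Set X))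
    {P : Set (X × X)} {Γ : Set (Curve X)} (hP : IsEndpointSet P Γ) {ρ : X → ℝ≥0∞}
    (hρ : LowerSemicontinuous ρ) (hρΓ : Admissible Γ ρ) (hρQ : ∫⁻ y, ρ y ^ Q ∂μ ≠ ∞)
    {δ : ℝ≥0} (hδ : 0 < δ) (hδρ : ∀ y, δ ≤ ρ y) :
    ∃ ε : ℝ, 0 < ε ∧ ∀ (S : Set (Set X)) (x : S → X) (r : S → ℝ), IsRoundCover K ε S x r →
      ∀ γ ∈ Γ, 2⁻¹ ≤ graphLength (pieceWeight K r ρ) (piecesMeeting S (range γ)) := by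
  by_contra! hcon
  have hK0 : 0 < K := one_pos.trans_le hK
  set ε : ℕ → ℝ := fun k ↦ min (1 / ((k : ℝ) + 1)) (Metric.diam (univ : Set X)) with hε
  have hε0 : ∀ k, 0 < ε k := fun k ↦ lt_min Nat.one_div_pos_of_nat hX
  have hεX : ∀ k, ε k ≤ Metric.diam (univ : Set X) := fun k ↦ min_le_right _ _
  have hεlim : Tendsto ε atTop (𝓝 0) := squeeze_zero (fun k ↦ (hε0 k).le)
    (fun k ↦ min_le_left _ _) tendsto_one_div_add_atTop_nhds_zero_nat
  choose S x r hS γ hγ hlt using fun k ↦ hcon (ε k) (hε0 k)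
  choose u v huv using fun k ↦ hP.exists_mem (γ k) (hγ k)
  have hfin : ∀ k, Finite (S k) := fun k ↦ (hS k).finite
  have hchain : ∀ k, ∃ (n : ℕ) (p : ℕ → piecesMeeting (S k) (range (γ k))) (y : ℕ → X),
      InjOn p (Iio (n + 1)) ∧ y 0 = γ k (u k) ∧ y (n + 1) = γ k (v k) ∧
      ∀ i < n + 1, y i ∈ closure ((p i : S k) : Set X) ∧
        y (i + 1) ∈ closure ((p i : S k) : Set X) := fun k ↦ by
    refine exists_chain_of_isPreconnected
      (B := fun s : piecesMeeting (S k) (range (γ k)) ↦ ((s : S k) : Set X))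
      (isPreconnected_range (γ k).continuous) ?_
      (mem_range_self _) (mem_range_self _)
    intro z hz
    obtain ⟨s, hs, hzs⟩ := mem_sUnion.1 ((hS k).cover ▸ mem_univ z)
    exact mem_iUnion.2 ⟨⟨⟨s, hs⟩, z, hzs, hz⟩, hzs⟩
  choose n p y hinj hy0 hy1 hyp using hchain
  set a : ℕ → ℕ → ℝ := fun k i ↦ 2 * K * r k (p k i) with ha
  set m : ℕ → ℕ → ℝ≥0∞ := fun k i ↦ ⨅ z ∈ ((p k i : S k) : Set X), ρ z with hm
  have ha0 : ∀ k i, 0 < a k i := fun k i ↦ by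
    have := (hS k).pos (p k i)
    positivity
  have haε : ∀ k i, a k i ≤ 2 * K * ε k := fun k i ↦
    mul_le_mul_of_nonneg_left ((hS k).le _) (by positivity)
  have hdist : ∀ k i, ∀ z ∈ closure ((p k i : S k) : Set X),
      ∀ z' ∈ closure ((p k i : S k) : Set X), dist z z' ≤ a k i := fun k i z hz z' hz' ↦ by
    have hsub := closure_minimal ((hS k).subset_closedBall (p k i)) Metric.isClosed_closedBall
    have h1 := Metric.mem_closedBall.1 (hsub hz)
    have h2 := Metric.mem_closedBall.1 (hsub hz')
    have := dist_triangle_right z z' (x k (p k i))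
    simp only [ha]
    linarith
  have hB : ∀ k, ∑ i ∈ Finset.range (n k + 1), ENNReal.ofReal (a k i) * m k i ≤ 2⁻¹ := fun k ↦ by
    have hinj' : InjOn (p k) (Finset.range (n k + 1)) := by
      rw [Finset.coe_range]; exact hinj k
    refine le_trans ?_ (hlt k).le
    classical
    calc ∑ i ∈ Finset.range (n k + 1), ENNReal.ofReal (a k i) * m k i
        = ∑ i ∈ Finset.range (n k + 1), (pieceWeight K (r k) ρ (p k i) : ℝ≥0∞) :=
          Finset.sum_congr rfl fun i _ ↦ (coe_pieceWeight hμ hQ hA (hεX k) (hS k) hρQ _).symm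
      _ = ∑ s ∈ (Finset.range (n k + 1)).image (p k), (pieceWeight K (r k) ρ s : ℝ≥0∞) :=
          (Finset.sum_image (f := fun s : piecesMeeting (S k) (range (γ k)) ↦
            (pieceWeight K (r k) ρ s : ℝ≥0∞)) hinj').symm
      _ ≤ graphLength (pieceWeight K (r k) ρ) (piecesMeeting (S k) (range (γ k))) :=
          ENNReal.sum_le_tsum _
  have hM : ∀ k, ∑ i ∈ Finset.range (n k + 1), a k i ≤ (2 * δ : ℝ)⁻¹ := fun k ↦ by
    have h1 : ENNReal.ofReal (∑ i ∈ Finset.range (n k + 1), a k i) * δ ≤ 2⁻¹ := by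
      refine le_trans ?_ (hB k)
      rw [ENNReal.ofReal_sum_of_nonneg fun i _ ↦ (ha0 k i).le, Finset.sum_mul]
      exact Finset.sum_le_sum fun i _ ↦ mul_le_mul_right (le_iInf₂ fun z _ ↦ hδρ z) _
    have h2 := ENNReal.toReal_mono (by simp) h1
    rw [ENNReal.toReal_mul, ENNReal.toReal_ofReal (Finset.sum_nonneg fun i _ ↦ (ha0 k i).le),
      ENNReal.coe_toReal, ENNReal.toReal_inv, ENNReal.toReal_ofNat] at h2
    have hδ' : (0 : ℝ) < δ := hδ
    rw [mul_inv, ← div_eq_mul_inv, le_div_iff₀ hδ']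
    exact h2
  obtain ⟨γ', hrect, hint, φ, hφ, h0, h1⟩ := exists_curve_of_chains hρ
    (η := fun k ↦ 2 * K * ε k) (y := y) (a := a) (m := m) (N := fun k ↦ n k + 1)
    (by simpa using hεlim.const_mul (2 * K)) (fun k ↦ Nat.succ_pos _) ha0 haε
    (fun k i hi ↦ hdist k i _ (hyp k i hi).1 _ (hyp k i hi).2) hM
    (fun k i hi ↦ le_iInf₂ fun z hz ↦ iInf₂_le z
      ((hdist k i _ (subset_closure hz) _ (hyp k i hi).1).trans (haε k i))) hB
  have hmem : (γ' 0, γ' 1) ∈ P := by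
    refine hP.isClosed.mem_of_tendsto (h0.prodMk_nhds h1) (Eventually.of_forall fun k ↦ ?_)
    simp only [hy0, hy1]
    exact huv _
  have := (hρΓ.2 γ' (hP.mem γ' hmem) hrect).trans hint
  simp at this

end CombinatorialLeAnalytic

/-! ### Families described by their end points -/

section Discretization

variable {X : Type*} [MetricSpace X]

theorem isEndpointSet_curvesOfDiam [CompactSpace X] (L : ℝ) :
    IsEndpointSet {z : X × X | L ≤ dist z.1 z.2} (curvesOfDiam X L) where
  isClosed := isClosed_le continuous_const (continuous_fst.dist continuous_snd)
  exists_mem γ hγ := by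
    obtain ⟨⟨u, v⟩, -, hmax⟩ := (isCompact_univ (X := unitInterval × unitInterval)).exists_isMaxOn
      univ_nonempty (f := fun w ↦ dist (γ w.1) (γ w.2)) (by fun_prop)
    refine ⟨u, v, le_trans hγ (Metric.diam_le_of_forall_dist_le dist_nonneg ?_)⟩
    rintro _ ⟨s, rfl⟩ _ ⟨t, rfl⟩
    exact hmax (mem_univ (s, t))
  mem γ h := le_trans h (Metric.dist_le_diam_of_mem (isCompact_range γ.continuous).isBounded
    (mem_range_self _) (mem_range_self _))

theorem IsCondenser.isEndpointSet {E F : Set X} (h : IsCondenser E F) :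
    IsEndpointSet (E ×ˢ F) (curvesJoining E F) where
  isClosed := h.left.isCompact.isClosed.prod h.right.isCompact.isClosed
  exists_mem _ hγ := ⟨0, 1, hγ⟩
  mem _ h := h

theorem IsCondenser.exists_pos_le_dist {E F : Set X} (h : IsCondenser E F) :
    ∃ d : ℝ, 0 < d ∧ ∀ z ∈ E ×ˢ F, d ≤ dist z.1 z.2 := by
  obtain ⟨d, hd, hEF⟩ := Metric.exists_pos_forall_lt_edist h.left.isCompact
    h.right.isCompact.isClosed h.disjoint
  refine ⟨d, hd, fun z hz ↦ ?_⟩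
  have := hEF z.1 hz.1 z.2 hz.2
  rw [edist_nndist, ENNReal.coe_lt_coe] at this
  exact_mod_cast this.le

theorem combModulus_empty {Q : ℝ} (hQ : 0 < Q) {S : Set (Set X)} (hS : S.Nonempty) :
    combModulus Q S ∅ = 0 := by
  classical
  obtain ⟨s, hs⟩ := hS
  have hvol : graphVolume Q (Pi.single (⟨s, hs⟩ : S) (1 : ℝ≥0)) = 1 := by
    rw [graphVolume, tsum_eq_single ⟨s, hs⟩ fun t ht ↦ by
      rw [Pi.single_eq_of_ne ht, ENNReal.coe_zero, ENNReal.zero_rpow_of_pos hQ]]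
    simp
  refine le_antisymm ((iInf₂_le (Pi.single (⟨s, hs⟩ : S) (1 : ℝ≥0)) ?_).trans_eq ?_) zero_le
  · rw [IsWeight, hvol]
    exact ⟨one_pos, ENNReal.one_lt_top⟩
  · simp [graphInfLength, hvol, ENNReal.top_rpow_of_pos hQ]

variable [MeasurableSpace X] {μ : Measure X} {Q A K : ℝ}

/-- The constant in `eventually_combModulus_le`. -/
noncomputable def combConst (Q A K : ℝ) : ℝ≥0 := 2 ^ Q * pieceConst Q A K

/-- Admissible functions may be assumed to be lower semicontinuous and bounded away from `0`. -/
theorem Admissible.exists_lowerSemicontinuous [BorelSpace X] [IsFiniteMeasure μ] (hQ : 0 < Q)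
    {Γ : Set (Curve X)} {ρ : X → ℝ≥0∞} (hρ : Admissible Γ ρ) {b : ℝ≥0∞}
    (hb : ∫⁻ y, ρ y ^ Q ∂μ < b) :
    ∃ (ρ' : X → ℝ≥0∞) (δ : ℝ≥0), LowerSemicontinuous ρ' ∧ Admissible Γ ρ' ∧ 0 < δ ∧
      (∀ y, δ ≤ ρ' y) ∧ ∫⁻ y, ρ' y ^ Q ∂μ < b := by
  obtain ⟨c, hIc, hcb⟩ := exists_between hb
  set I := ∫⁻ y, ρ y ^ Q ∂μ with hI
  have hτ : (c - I) / 2 ≠ 0 := (ENNReal.half_pos (tsub_pos_of_lt hIc).ne').ne'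
  obtain ⟨e, he0, he⟩ := ENNReal.exists_nnreal_pos_mul_lt (measure_ne_top μ univ) hτ
  obtain ⟨g, hfg, hg, hgint⟩ := exists_le_lowerSemicontinuous_lintegral_ge (μ := μ)
    (fun y ↦ ρ y ^ Q + e) ((hρ.1.pow_const Q).add_const _) hτ
  have hroot : ∀ {t : ℝ≥0∞} {y}, t ^ Q ≤ g y → t ≤ g y ^ (1 / Q) := fun {t y} h ↦
    by
    rwa [one_div, ENNReal.le_rpow_inv_iff hQ]
  have hlsc : LowerSemicontinuous fun y ↦ g y ^ (1 / Q) :=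
    ENNReal.continuous_rpow_const.comp_lowerSemicontinuous hg
      (ENNReal.monotone_rpow_of_nonneg (by positivity))
  refine ⟨fun y ↦ g y ^ (1 / Q), e ^ (1 / Q), hlsc, ⟨hlsc.measurable, fun γ hγ hrect ↦ ?_⟩,
    NNReal.rpow_pos he0, fun y ↦ hroot ?_, ?_⟩
  · exact (hρ.2 γ hγ hrect).trans (lintegral_mono fun t ↦ hroot (le_self_add.trans (hfg _)))
  · rw [ENNReal.coe_rpow_of_nonneg _ (by positivity), ← ENNReal.rpow_mul,
      one_div_mul_cancel hQ.ne', ENNReal.rpow_one]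
    exact le_add_self.trans (hfg y)
  · simp only [← ENNReal.rpow_mul, one_div_mul_cancel hQ.ne', ENNReal.rpow_one]
    refine hgint.trans_lt (lt_of_le_of_lt ?_ hcb)
    rw [lintegral_add_right _ measurable_const, lintegral_const]
    calc I + e * μ univ + (c - I) / 2 ≤ I + (c - I) / 2 + (c - I) / 2 := by gcongr
      _ = c := by rw [add_assoc, ENNReal.add_halves, add_tsub_cancel_of_le hIc.le]

theorem eventually_combModulus_le [BorelSpace X] [CompactSpace X] [Nonempty X]
    (hμ : AhlforsRegular μ Q A) (hQ : 1 < Q) (hA : 1 ≤ A) (hK : 1 ≤ K)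
    (hX : 0 < Metric.diam (univ : Set X)) {S : ℕ → Set (Set X)}
    (hS : ∀ n, IsQuasiPacking K (S n)) (hmesh : Tendsto (fun n ↦ mesh (S n)) atTop (𝓝 0))
    {P : Set (X × X)} {Γ : Set (Curve X)} (hP : IsEndpointSet P Γ) {b : ℝ≥0∞}
    (hb : modulus μ Q Γ < b) :
    ∀ᶠ n in atTop, combModulus Q (S n) Γ ≤ combConst Q A K * b := by
  have hQ0 : 0 < Q := one_pos.trans hQ
  have := hμ.isFiniteMeasure hX
  obtain ⟨ρ₀, hρ₀, hb₀⟩ := by simpa only [modulus, iInf_lt_iff] using hb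
  obtain ⟨ρ, δ, hρ, hρΓ, hδ, hδρ, hρb⟩ := hρ₀.exists_lowerSemicontinuous hQ0 hb₀
  obtain ⟨ε, hε, hlen⟩ := exists_half_le_graphLength hμ hQ hA hK hX hP hρ hρΓ hρb.ne_top hδ hδρ
  filter_upwards [eventually_exists_isRoundCover hμ hQ0 hA hX hS hmesh (lt_min hε hX)]
    with n ⟨x, r, hn⟩
  have hn' : IsRoundCover K ε (S n) x r :=
    { hn with le := fun s ↦ (hn.le s).trans (min_le_left _ _) }
  set w := pieceWeight K r ρ with hw
  have hvol : graphVolume Q w ≤ pieceConst Q A K * ∫⁻ y, ρ y ^ Q ∂μ :=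
    graphVolume_pieceWeight_le hμ hQ hA hK (min_le_right _ _) hn hρ.measurable
  have hweight : IsWeight Q w := by
    refine ⟨?_, hvol.trans_lt (ENNReal.mul_lt_top ENNReal.coe_lt_top hρb.lt_top)⟩
    obtain ⟨z⟩ := ‹Nonempty X›
    obtain ⟨s, hs, -⟩ := mem_sUnion.1 (hn.cover ▸ mem_univ z)
    have hpos : 0 < (w ⟨s, hs⟩ : ℝ≥0∞) := by
      rw [coe_pieceWeight hμ hQ hA (min_le_right _ _) hn hρb.ne_top]
      have := hn.pos ⟨s, hs⟩
      exact ENNReal.mul_pos (ENNReal.ofReal_pos.2 (by positivity)).ne'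
        ((ENNReal.coe_pos.2 hδ).trans_le (le_iInf₂ fun z _ ↦ hδρ z)).ne'
    exact (ENNReal.rpow_pos hpos ENNReal.coe_ne_top).trans_le
      (ENNReal.le_tsum (f := fun s ↦ (w s : ℝ≥0∞) ^ Q) ⟨s, hs⟩)
  have hL : 2⁻¹ ≤ graphInfLength (G := nerve (S n)) w (curveTrace (S n) '' Γ) := by
    rw [graphInfLength_curveTrace_image]
    exact le_iInf₂ fun γ hγ ↦ hlen _ x r hn' γ hγ
  calc combModulus Q (S n) Γ
      ≤ graphVolume Q w / graphInfLength (G := nerve (S n)) w (curveTrace (S n) '' Γ) ^ Q :=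
        iInf₂_le w hweight
    _ ≤ graphVolume Q w / 2⁻¹ ^ Q := by gcongr
    _ = 2 ^ Q * graphVolume Q w := by
        rw [ENNReal.inv_rpow, div_eq_mul_inv, inv_inv, mul_comm]
    _ ≤ 2 ^ Q * (pieceConst Q A K * b) := by
        gcongr
        exact hvol.trans (mul_le_mul_right hρb.le _)
    _ = combConst Q A K * b := by
        rw [combConst, ENNReal.coe_mul, ENNReal.coe_rpow_of_nonneg _ hQ0.le, mul_assoc,
          ENNReal.coe_ofNat]

theorem modulus_empty (hQ : 0 < Q) : modulus μ Q ∅ = 0 := by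
  refine le_antisymm ((iInf₂_le (fun _ ↦ 0) ⟨measurable_const, by simp⟩).trans_eq ?_) zero_le
  simp [ENNReal.zero_rpow_of_pos hQ]

/-- The comparison for any family of curves described by its end points, those being at distances
bounded away from `0`. -/
theorem modulusDiscretized_of_isEndpointSet [BorelSpace X] [CompactSpace X] [Nonempty X]
    (hμ : AhlforsRegular μ Q A) (hQ : 1 < Q) (hA : 1 ≤ A) (hK : 1 ≤ K) {S : ℕ → Set (Set X)}
    (hS : ∀ n, IsQuasiPacking K (S n)) (hmesh : Tendsto (fun n ↦ mesh (S n)) atTop (𝓝 0))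
    {P : Set (X × X)} {Γ : Set (Curve X)} (hP : IsEndpointSet P Γ) {d : ℝ} (hd : 0 < d)
    (hPd : ∀ z ∈ P, d ≤ dist z.1 z.2) :
    ModulusDiscretized μ Q (analyticConst Q A K + 2 * combConst Q A K) S Γ := by
  have hQ0 : 0 < Q := one_pos.trans hQ
  have hK0 : 0 < K := one_pos.trans_le hK
  rcases (Metric.diam_nonneg (s := (univ : Set X))).eq_or_lt with hX | hX
  · -- a one-point space carries no curve of the family
    have hΓ : Γ = ∅ := eq_empty_of_forall_notMem fun γ hγ ↦ by
      obtain ⟨u, v, huv⟩ := hP.exists_mem γ hγ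
      have h1 := hPd _ huv
      have h2 := Metric.dist_le_diam_of_mem isCompact_univ.isBounded (mem_univ (γ u))
        (mem_univ (γ v))
      simp only at h1
      linarith
    subst hΓ
    have hSne : ∀ n, (S n).Nonempty := fun n ↦ by
      obtain ⟨z⟩ := ‹Nonempty X›
      obtain ⟨s, hs, -⟩ := mem_sUnion.1 ((hS n).cover ▸ mem_univ z)
      exact ⟨s, hs⟩
    refine ⟨fun h ↦ absurd (modulus_empty hQ0) h.ne', fun _ ↦ ?_⟩
    simp only [combModulus_empty hQ0 (hSne _)]
    exact tendsto_const_nhds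
  refine ⟨fun hpos ↦ ?_, fun hzero ↦ ?_⟩
  · have hsmall : ∃ ε : ℝ, 0 < ε ∧ 10 * K * ε ≤ Metric.diam (univ : Set X) ∧ 4 * K * ε < d := by
      refine ⟨min (Metric.diam (univ : Set X)) (d / 2) / (10 * K),
        div_pos (lt_min hX (half_pos hd)) (by positivity), ?_, ?_⟩
      · rw [mul_div_cancel₀ _ (by positivity)]
        exact min_le_left _ _
      · have h := min_le_right (Metric.diam (univ : Set X)) (d / 2)
        rw [mul_div_assoc', div_lt_iff₀ (by positivity)]
        nlinarith
    obtain ⟨ε, hε, hεX, hεd⟩ := hsmall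
    have hcomb : ∀ᶠ n in atTop, combModulus Q (S n) Γ ≤
        (analyticConst Q A K + 2 * combConst Q A K : ℝ≥0) * modulus μ Q Γ := by
      rcases eq_or_ne (modulus μ Q Γ) ∞ with htop | htop
      · refine Eventually.of_forall fun n ↦ ?_
        rw [htop, ENNReal.mul_top]
        · exact le_top
        · rw [analyticConst, ENNReal.coe_ne_zero]
          positivity
      · have hlt : modulus μ Q Γ < 2 * modulus μ Q Γ := by
          rw [two_mul]
          exact ENNReal.lt_add_right htop hpos.ne'
        filter_upwards [eventually_combModulus_le hμ hQ hA hK hX hS hmesh hP hlt] with n hn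
        refine hn.trans ?_
        rw [mul_left_comm, ← mul_assoc, ENNReal.coe_add, ENNReal.coe_mul, ENNReal.coe_ofNat]
        gcongr
        exact le_add_self
    filter_upwards [hcomb, eventually_exists_isRoundCover hμ hQ0 hA hX hS hmesh hε]
      with n hn ⟨x, r, hxr⟩
    refine ⟨(modulus_le_mul_combModulus hμ hQ hA hK hX hεX hxr fun γ hγ ↦ ?_).trans ?_, hn⟩
    · obtain ⟨u, v, huv⟩ := hP.exists_mem γ hγ
      exact ⟨u, v, hεd.trans_le (hPd _ huv)⟩
    · gcongr
      exact le_self_add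
  · rw [ENNReal.tendsto_nhds_zero]
    intro e he
    have hb : modulus μ Q Γ < e / (combConst Q A K + 1 : ℝ≥0) := by
      rw [hzero]
      exact ENNReal.div_pos he.ne' ENNReal.coe_ne_top
    filter_upwards [eventually_combModulus_le hμ hQ hA hK hX hS hmesh hP hb] with n hn
    refine hn.trans ?_
    calc (combConst Q A K : ℝ≥0∞) * (e / (combConst Q A K + 1 : ℝ≥0))
        ≤ (combConst Q A K + 1 : ℝ≥0) * (e / (combConst Q A K + 1 : ℝ≥0)) := by
          gcongr
          exact le_self_add
      _ ≤ e := ENNReal.mul_div_le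

end Discretization

end CombMod

theorem propositionB2 (Q A K : ℝ) (hQ : 1 < Q) (hA : 1 ≤ A) (hK : 1 ≤ K) :
    ∃ C : ℝ≥0, 1 ≤ C ∧
      ∀ (X : Type*) [MetricSpace X] [CompactSpace X] [Nonempty X]
        [MeasurableSpace X] [BorelSpace X] (μ : Measure X),
        CombMod.AhlforsRegular μ Q A →
        ∀ S : ℕ → Set (Set X),
          (∀ n, CombMod.IsQuasiPacking K (S n)) →
          Tendsto (fun n => CombMod.mesh (S n)) atTop (𝓝 0) →
          (∀ L : ℝ, 0 < L →
            CombMod.ModulusDiscretized μ Q C S (CombMod.curvesOfDiam X L)) ∧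
          (∀ E F : Set X, CombMod.IsCondenser E F →
            CombMod.ModulusDiscretized μ Q C S (CombMod.curvesJoining E F)) := by
  refine ⟨CombMod.analyticConst Q A K + 2 * CombMod.combConst Q A K, ?_, ?_⟩
  · exact le_add_right (le_add_left le_rfl)
  · intro X _ _ _ _ _ μ hμ S hS hmesh
    refine ⟨fun L hL ↦ ?_, fun E F hEF ↦ ?_⟩
    · exact CombMod.modulusDiscretized_of_isEndpointSet hμ hQ hA hK hS hmesh
        (CombMod.isEndpointSet_curvesOfDiam L) hL fun z hz ↦ hz
    · obtain ⟨d, hd, hdist⟩ := hEF.exists_pos_le_dist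
      exact CombMod.modulusDiscretized_of_isEndpointSet hμ hQ hA hK hS hmesh
        hEF.isEndpointSet hd hdist
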